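/- **Corollary 3.3.** Let $|\cdot|$ be a norm on $\mathbb R^n$ and $\|\cdot\|$ the induced matrix norm. Let $(t_i)_{i\in\mathbb Z}$, $(\zeta_i)_{i\in\mathbb Z}$ be real sequences with $t_i<t_{i+1}$, $t_i\le\zeta_i\le t_{i+1}$, $t_i\to\pm\infty$ as $i\to\pm\infty$, and $t_{i+1}-t_i\le\theta$ for all $i$, for some $\theta>0$; let $\gamma(t)=\zeta_i$ for $t\in[t_i,t_{i+1})$. Let $A_0:\mathbb R\to M_n(\mathbb R)$ and $f:\mathbb R\times\mathbb R^n\times\mathbb R^n\to\mathbb R^n$ be such that $A_0$ and every $t\mapsto f(t,x,y)$ are continuous on each $[t_i,t_{i+1})$ with a finite left limit at $t_{i+1}$ (for example, continuous on $\mathbb R$). Suppose there are positive constants $M_0,\mu,\ell_1,\ell_2$ such that for all $t,x,x',y,y'$ $$\|A_0(t)\|\le M_0,\qquad |f(t,x,y)|\le\mu,\qquad |f(t,x,y)-f(t,x',y')|\le \ell_1|x-x'|+\ell_2|y-y'| .$$ Consider the systems $$y'(t)=A_0(t)\,y(\gamma(t))\quad(1)\qquad\text{and}\qquad x'(t)=A_0(t)\,x(\gamma(t))+f(t,x(t),x(\gamma(t)))\quad(2).$$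 A solution of (1) or (2) is a continuous function on $\mathbb R$ which has both one-sided derivatives at every $t_i$, satisfies the equation on every $(t_i,t_{i+1})$, and satisfies it with the right derivative at every $t_i$. Put $E(t,\tau)=I+\int_\tau^tA_0(s)\,ds$ and let $Z(t,\tau)$ be the transition matrix of (1): $Z(t,\tau)=E(t,\zeta_i)E(\tau,\zeta_i)^{-1}$ for $t,\tau\in[t_i,t_{i+1}]$, and $Z(t,s)Z(s,\tau)=Z(t,\tau)$ for all $t,s,\tau$ (the matrices $E(\tau,\zeta_i)$ with $\tau\in[t_i,t_{i+1}]$ are invertible under the condition $\tilde u_0<1$ below). Assume that (1) has an $\alpha$-exponential dichotomy: there are a matrix $P=P^2$ and constants $K\ge1$, $\alpha>0$ such that, for all $s,t\in\mathbb R$, $\|Z_P(t,s)\|\le Ke^{-\alpha|t-s|}$, where $Z_P(t,s)=Z(t,0)PZ(0,s)$ if $t\ge s$ and $Z_P(t,s)=-Z(t,0)(I-P)Z(0,s)$ if $s>t$. Assume moreover $$2(\ell_1+\ell_2)Ke^{\alpha\theta}<\alpha,\qquad \tilde v_0:=\frac{e^{\ell_1\theta}-1}{\ell_1\theta}\,(M_0+\ell_2)\theta<1,\qquad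 \tilde u_0:=(M_0+\ell_2)\theta<1 .$$ Then (1) and (2) are strongly topologically equivalent: there are functions $H,L:\mathbb R\times\mathbb R^n\to\mathbb R^n$ such that, for each $t$, $H(t,\cdot)$ and $L(t,\cdot)$ are mutually inverse homeomorphisms of $\mathbb R^n$; $H(t,u)-u$ and $L(t,u)-u$ are bounded on $\mathbb R\times\mathbb R^n$; if $x$ is a solution of (2) then $t\mapsto H(t,x(t))$ is a solution of (1); if $y$ is a solution of (1) then $t\mapsto L(t,y(t))$ is a solution of (2); and the maps $H(t,\cdot)$ and $L(t,\cdot)$ are uniformly continuous, uniformly in $t\in\mathbb R$. If in addition $$\alpha<\min\Big\{\ell_1+\frac{M_0+\ell_2}{1-\tilde v_0}e^{\ell_1\theta},\ \frac{M_0}{1-\tilde u_0}\Big\},$$ then (1) and (2) are Hölder strongly topologically equivalent: $H$ and $L$ as above can be chosen such that, for some $C_1,D_1>1$ and $C_2,D_2\in(0,1)$ and all $t\in\mathbb R$, $$|H(t,\xi)-H(t,\xi')|\le C_1|\xi-\xi'|^{C_2}\quad\text{and}\quad |L(t,\nu)-L(t,\nu')|\le D_1|\nu-\nu'|^{D_2}$$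 whenever $|\xi-\xi'|<1$ and $|\nu-\nu'|<1$. -/

import Mathlib

open Set Filter Topology

noncomputable section

namespace DEPCAG

/-- The standing conditions on a piecewise constant argument: `t i < t (i+1)`,
`t i ≤ ζ i ≤ t (i+1)`, `t i → ±∞` as `i → ±∞`, `γ = ζ i` on `[t i, t (i+1))`, and
`t (i+1) - t i ≤ θ` with `θ > 0`. -/
structure IsPiecewiseConstArg (t ζ : ℤ → ℝ) (γ : ℝ → ℝ) (θ : ℝ) : Prop where
  lt_succ : ∀ i, t i < t (i + 1)
  le_zeta : ∀ i, t i ≤ ζ i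
  zeta_le : ∀ i, ζ i ≤ t (i + 1)
  tendsto_top : Tendsto t atTop atTop
  tendsto_bot : Tendsto t atBot atBot
  arg_eq : ∀ i, ∀ s ∈ Ico (t i) (t (i + 1)), γ s = ζ i
  theta_pos : 0 < θ
  gap_le : ∀ i, t (i + 1) - t i ≤ θ

/-- Continuity on every `[t i, t (i+1))`, with a finite left limit at `t (i+1)`;
every continuous function has this property. -/
def PiecewiseContinuous {X : Type*} [TopologicalSpace X] (t : ℤ → ℝ) (g : ℝ → X) : Prop :=
  ∀ i, ContinuousOn g (Ico (t i) (t (i + 1))) ∧ ∃ l, Tendsto g (𝓝[<] t (i + 1)) (𝓝 l)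

/-- `i(s)`: the integer `i` with `s ∈ [t i, t (i+1))`. -/
def idx (t : ℤ → ℝ) (s : ℝ) : ℤ :=
  Classical.epsilon fun i => s ∈ Ico (t i) (t (i + 1))

variable {E : Type*} [NormedAddCommGroup E] [NormedSpace ℝ E]

/-- Solutions on `ℝ` of `u'(s) = F(s, u(s), u(γ(s)))`: continuous, with both one-sided
derivatives at the points `t i`; the equation holds on every `(t i, t (i+1))`, and at `t i` for
the right derivative. -/
def IsSolution (t : ℤ → ℝ) (γ : ℝ → ℝ) (F : ℝ → E → E → E) (u : ℝ → E) : Prop :=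
  Continuous u ∧
  (∀ i, ∀ s ∈ Ioo (t i) (t (i + 1)), HasDerivAt u (F s (u s) (u (γ s))) s) ∧
  (∀ i, HasDerivWithinAt u (F (t i) (u (t i)) (u (γ (t i)))) (Ioi (t i)) (t i)) ∧
  (∀ i, DifferentiableWithinAt ℝ u (Iio (t i)) (t i))

/-- The right-hand side of the linear system `y' = A₀(s) y(γ(s))`. -/
def linRHS (A₀ : ℝ → E →L[ℝ] E) : ℝ → E → E → E :=
  fun s _ y => A₀ s y

/-- The right-hand side of the system `x' = A₀(s) x(γ(s)) + f(s, x(s), x(γ(s)))`. -/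
def quasiRHS (A₀ : ℝ → E →L[ℝ] E) (f : ℝ → E → E → E) : ℝ → E → E → E :=
  fun s x y => A₀ s y + f s x y

/-- `E(s, τ) = I + ∫_τ^s A₀(r) dr`. -/
def evol (A₀ : ℝ → E →L[ℝ] E) (s τ : ℝ) : E →L[ℝ] E :=
  1 + ∫ r in τ..s, A₀ r

/-- Transition from `t k` to `t (k+1)`. -/
def stepFwd (A₀ : ℝ → E →L[ℝ] E) (t ζ : ℤ → ℝ) (k : ℤ) : E →L[ℝ] E :=
  evol A₀ (t (k + 1)) (ζ k) * Ring.inverse (evol A₀ (t k) (ζ k))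

/-- Transition from `t (k+1)` to `t k`. -/
def stepBwd (A₀ : ℝ → E →L[ℝ] E) (t ζ : ℤ → ℝ) (k : ℤ) : E →L[ℝ] E :=
  evol A₀ (t k) (ζ k) * Ring.inverse (evol A₀ (t (k + 1)) (ζ k))

/-- The backward product of the forward steps: transition from `t i` to `t (i+n)`. -/
def prodFwd (A₀ : ℝ → E →L[ℝ] E) (t ζ : ℤ → ℝ) (i : ℤ) : ℕ → (E →L[ℝ] E)
  | 0 => 1
  | n + 1 => stepFwd A₀ t ζ (i + n) * prodFwd A₀ t ζ i n

/-- The forward product of the backward steps: transition from `t i` to `t (i-n)`. -/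
def prodBwd (A₀ : ℝ → E →L[ℝ] E) (t ζ : ℤ → ℝ) (i : ℤ) : ℕ → (E →L[ℝ] E)
  | 0 => 1
  | n + 1 => stepBwd A₀ t ζ (i - n - 1) * prodBwd A₀ t ζ i n

/-- Transition from `t i` to `t j`. -/
def gridTransition (A₀ : ℝ → E →L[ℝ] E) (t ζ : ℤ → ℝ) (i j : ℤ) : E →L[ℝ] E :=
  if i ≤ j then prodFwd A₀ t ζ i (j - i).toNat else prodBwd A₀ t ζ i (i - j).toNat

/-- The transition matrix `Z(s, τ)` of `y' = A₀(s) y(γ(s))`: with `τ ∈ [t i, t (i+1))` and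
`s ∈ [t j, t (j+1))`, go from `τ` to `t i`, then along the grid to `t j`, then to `s`. -/
def transition (A₀ : ℝ → E →L[ℝ] E) (t ζ : ℤ → ℝ) (s τ : ℝ) : E →L[ℝ] E :=
  (evol A₀ s (ζ (idx t s)) * Ring.inverse (evol A₀ (t (idx t s)) (ζ (idx t s)))) *
    gridTransition A₀ t ζ (idx t τ) (idx t s) *
    (evol A₀ (t (idx t τ)) (ζ (idx t τ)) * Ring.inverse (evol A₀ τ (ζ (idx t τ))))

/-- `Z_P(s, r) = Z(s,0) P Z(0,r)` for `s ≥ r`, and `-Z(s,0) (I - P) Z(0,r)` for `r > s`. -/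
def transitionProj (A₀ : ℝ → E →L[ℝ] E) (t ζ : ℤ → ℝ) (P : E →L[ℝ] E) (s r : ℝ) : E →L[ℝ] E :=
  if r ≤ s then transition A₀ t ζ s 0 * P * transition A₀ t ζ 0 r
  else -(transition A₀ t ζ s 0 * (1 - P) * transition A₀ t ζ 0 r)

/-- The linear system has an `α`-exponential dichotomy on `ℝ` with constant `K`. -/
def HasExpDichotomy (A₀ : ℝ → E →L[ℝ] E) (t ζ : ℤ → ℝ) (K α : ℝ) : Prop :=
  1 ≤ K ∧ 0 < α ∧ ∃ P : E →L[ℝ] E, P * P = P ∧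
    ∀ s r, ‖transitionProj A₀ t ζ P s r‖ ≤ K * Real.exp (-α * |s - r|)

/-- `H`, with fibrewise inverse `L`, is a topological equivalence between the systems with
right-hand sides `G` and `F`: `H` maps solutions for `F` to solutions for `G`, `L` those for `G`
to those for `F`. -/
structure IsTopEquivalence (t : ℤ → ℝ) (γ : ℝ → ℝ) (G F : ℝ → E → E → E)
    (H L : ℝ → E → E) : Prop where
  left_inv : ∀ s u, L s (H s u) = u
  right_inv : ∀ s u, H s (L s u) = u
  homeo : ∀ s, IsHomeomorph (H s)
  homeo_inv : ∀ s, IsHomeomorph (L s)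
  bounded : ∃ B, ∀ s u, ‖H s u - u‖ ≤ B
  bounded_inv : ∃ B, ∀ s u, ‖L s u - u‖ ≤ B
  map_sol : ∀ x, IsSolution t γ F x → IsSolution t γ G (fun s => H s (x s))
  map_sol_inv : ∀ y, IsSolution t γ G y → IsSolution t γ F (fun s => L s (y s))

/-- Uniform continuity of all maps `u ↦ H s u`, with `δ` independent of `s`. -/
def UnifContAll (H : ℝ → E → E) : Prop :=
  ∀ ε > 0, ∃ δ > 0, ∀ s u v, ‖u - v‖ < δ → ‖H s u - H s v‖ < ε

/-- `‖H s u - H s v‖ ≤ C ‖u - v‖ ^ κ` for all `s` and `‖u - v‖ < 1`, for some `C > 1` and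
`κ ∈ (0,1)`. -/
def HolderAll (H : ℝ → E → E) : Prop :=
  ∃ C κ : ℝ, 1 < C ∧ 0 < κ ∧ κ < 1 ∧
    ∀ s u v, ‖u - v‖ < 1 → ‖H s u - H s v‖ ≤ C * ‖u - v‖ ^ κ

/-- Strong topological equivalence. -/
def StronglyTopEquiv (t : ℤ → ℝ) (γ : ℝ → ℝ) (G F : ℝ → E → E → E) : Prop :=
  ∃ H L : ℝ → E → E, IsTopEquivalence t γ G F H L ∧ UnifContAll H ∧ UnifContAll L

/-- Hölder strong topological equivalence. -/
def HolderStronglyTopEquiv (t : ℤ → ℝ) (γ : ℝ → ℝ) (G F : ℝ → E → E → E) : Prop :=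
  ∃ H L : ℝ → E → E, IsTopEquivalence t γ G F H L ∧ (UnifContAll H ∧ UnifContAll L) ∧
    HolderAll H ∧ HolderAll L

end DEPCAG

end

open Set Filter Topology

noncomputable section

namespace DEPCAG

section

/-! ### The grid and the index of a time -/

section Grid

variable {t ζ : ℤ → ℝ} {γ : ℝ → ℝ} {θ : ℝ}

/-! Solutions of the two systems are paired by staying at bounded distance from each other; `H` and
`L` send the value of one partner at time `s` to the value of the other. The core is the a priori
estimate `IsDichotomyProj.norm_le`: if `w' = A₀ w(γ) + g`, the stable part of `w` (transported to
time `0`) vanishes at `-∞` and the unstable part at `+∞`, and `‖g r‖ ≤ D e^{ε|r-s|}` with `0 ≤ ε <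
α`, then `‖w s‖ ≤ κ D` for `κ = 2K e^{αθ}/(α-ε)`. The elementary inequality `green_bound` yields
this `κ`, which is the constant matched to the smallness hypothesis.

Existence of partners uses `ε = 0`. A bounded forcing has a bounded response
(`exists_bounded_solution`); subtracting it from a nonlinear solution gives a linear one
(`exists_lin_near`). In the other direction the partner of `y` is `y + z`, with `z` a fixed point of
the response map, a contraction because `κ(ℓ₁+ℓ₂) < 1` (`exists_quasi_near`).

Regularity uses small `ε > 0`. For two pairs, `w = (x-x') - (y-y')` is a bounded response to the
difference of the values of `f`. That forcing is at most `2μ`, and also at most `c e^{p|r-τ|} δ`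
plus terms in `w`, where `δ` is the distance at `τ` of either `x, x'` or `y, y'` and `p` is the
growth rate from `exists_growth`. Interpolation gives a multiple of `e^{ε|r-τ|} δ^{ε/p}`, and the
terms in `w` are absorbed (`norm_le_of_weighted`). The resulting `exists_holder` gives uniqueness of
partners at `δ = 0`, hence mutual inverses, and Hölder continuity otherwise, hence uniform
continuity. -/

theorem IsPiecewiseConstArg.strictMono (h : IsPiecewiseConstArg t ζ γ θ) : StrictMono t :=
  strictMono_int_of_lt_succ h.lt_succ

theorem IsPiecewiseConstArg.exists_mem_Ico (h : IsPiecewiseConstArg t ζ γ θ) (s : ℝ) :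
    ∃ i, s ∈ Ico (t i) (t (i + 1)) := by
  obtain ⟨b, hb⟩ := (h.tendsto_top.eventually (eventually_gt_atTop s)).exists
  obtain ⟨a, ha⟩ := (h.tendsto_bot.eventually (eventually_le_atBot s)).exists
  obtain ⟨i, hi, hmax⟩ := Int.exists_greatest_of_bdd (P := fun i => t i ≤ s)
    ⟨b, fun z hz => (h.strictMono.lt_iff_lt.1 (hz.trans_lt hb)).le⟩ ⟨a, ha⟩
  refine ⟨i, hi, lt_of_not_ge fun hc => ?_⟩
  have := hmax _ hc
  omega

theorem IsPiecewiseConstArg.idx_mem (h : IsPiecewiseConstArg t ζ γ θ) (s : ℝ) :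
    s ∈ Ico (t (idx t s)) (t (idx t s + 1)) :=
  Classical.epsilon_spec (h.exists_mem_Ico s)

theorem IsPiecewiseConstArg.idx_eq (h : IsPiecewiseConstArg t ζ γ θ) {s : ℝ} {i : ℤ}
    (hs : s ∈ Ico (t i) (t (i + 1))) : idx t s = i := by
  have h1 := h.idx_mem s
  have h2 := h.strictMono.lt_iff_lt.1 (h1.1.trans_lt hs.2)
  have h3 := h.strictMono.lt_iff_lt.1 (hs.1.trans_lt h1.2)
  omega

theorem IsPiecewiseConstArg.zeta_mem (h : IsPiecewiseConstArg t ζ γ θ) (i : ℤ) :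
    ζ i ∈ Icc (t i) (t (i + 1)) := ⟨h.le_zeta i, h.zeta_le i⟩

theorem IsPiecewiseConstArg.left_mem (h : IsPiecewiseConstArg t ζ γ θ) (i : ℤ) :
    t i ∈ Icc (t i) (t (i + 1)) := left_mem_Icc.2 (h.lt_succ i).le

theorem IsPiecewiseConstArg.right_mem (h : IsPiecewiseConstArg t ζ γ θ) (i : ℤ) :
    t (i + 1) ∈ Icc (t i) (t (i + 1)) := right_mem_Icc.2 (h.lt_succ i).le

theorem IsPiecewiseConstArg.abs_sub_le (h : IsPiecewiseConstArg t ζ γ θ) {i : ℤ} {s r : ℝ}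
    (hs : s ∈ Icc (t i) (t (i + 1))) (hr : r ∈ Icc (t i) (t (i + 1))) : |s - r| ≤ θ := by
  have := h.gap_le i
  rw [abs_le]
  constructor <;> linarith [hs.1, hs.2, hr.1, hr.2]

theorem IsPiecewiseConstArg.abs_arg_sub_le (h : IsPiecewiseConstArg t ζ γ θ) (s : ℝ) :
    |γ s - s| ≤ θ := by
  obtain ⟨i, hi⟩ := h.exists_mem_Ico s
  rw [h.arg_eq i s hi]
  exact h.abs_sub_le (h.zeta_mem i) (Ico_subset_Icc_self hi)

/-- A function which is monotone on every grid interval is monotone. -/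
theorem IsPiecewiseConstArg.monotone_of_monotoneOn (h : IsPiecewiseConstArg t ζ γ θ) {φ : ℝ → ℝ}
    (hφ : ∀ i, MonotoneOn φ (Icc (t i) (t (i + 1)))) : Monotone φ := by
  have key : ∀ (i : ℤ) (n : ℕ), MonotoneOn φ (Icc (t i) (t (i + n))) := by
    intro i n
    induction n with
    | zero => simp
    | succ n ih =>
      have hle : t i ≤ t (i + n) := h.strictMono.monotone (by omega)
      have e : i + ((n + 1 : ℕ) : ℤ) = i + n + 1 := by push_cast; ring
      rw [e, ← Icc_union_Icc_eq_Icc hle (h.lt_succ _).le]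
      exact ih.union_right (hφ _) (isGreatest_Icc hle) (isLeast_Icc (h.lt_succ _).le)
  intro a b hab
  have ha := h.idx_mem a
  have hb := h.idx_mem b
  have hlt := h.strictMono.lt_iff_lt.1 ((ha.1.trans hab).trans_lt hb.2)
  refine key (idx t a) (idx t b + 1 - idx t a).toNat ⟨ha.1, ?_⟩ ⟨ha.1.trans hab, ?_⟩ hab
  all_goals
    rw [show idx t a + ((idx t b + 1 - idx t a).toNat : ℤ) = idx t b + 1 by omega]
    linarith [hb.2]

end Grid

/-! ### Piecewise continuous functions and their integrals -/

section PiecewiseContinuous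

variable {X : Type*} [NormedAddCommGroup X]

/-- Continuity on `[a, b)` with a limit from the left at `b`. -/
def ContinuousUpTo (a b : ℝ) (g : ℝ → X) : Prop :=
  ContinuousOn g (Ico a b) ∧ ∃ l, Tendsto g (𝓝[<] b) (𝓝 l)

/-- Filling in the left limit at `b` and extending by constants outside `[a, b]` gives a globally
continuous function, so the usual integral calculus applies on each grid interval. -/
theorem ContinuousUpTo.exists_continuous {a b : ℝ} {g : ℝ → X} (hab : a < b)
    (hg : ContinuousUpTo a b g) : ∃ g' : ℝ → X, Continuous g' ∧ EqOn g g' (Ico a b) := by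
  obtain ⟨hc, l, hl⟩ := hg
  have hcont : ContinuousOn (extendFrom (Ico a b) g) (Icc a b) := by
    refine continuousOn_extendFrom (by rw [closure_Ico hab.ne]) fun x hx => ?_
    rcases hx.2.lt_or_eq with h | h
    · exact ⟨_, hc x ⟨hx.1, h⟩⟩
    · subst h
      exact ⟨l, by rwa [nhdsWithin_Ico_eq_nhdsLT hab]⟩
  refine ⟨IccExtend hab.le ((Icc a b).domRestrict (extendFrom (Ico a b) g)),
    hcont.domRestrict.Icc_extend', fun s hs => ?_⟩
  rw [IccExtend_of_mem _ _ (Ico_subset_Icc_self hs), domRestrict_apply, extendFrom_extends hc s hs]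

theorem ContinuousUpTo.intervalIntegrable [NormedSpace ℝ X] {a b : ℝ} {g : ℝ → X} (hab : a < b)
    (hg : ContinuousUpTo a b g) {s r : ℝ} (hs : s ∈ Icc a b) (hr : r ∈ Icc a b) :
    IntervalIntegrable g MeasureTheory.volume s r := by
  obtain ⟨g', hg', heq⟩ := hg.exists_continuous hab
  refine (hg'.intervalIntegrable s r).congr_uIoo fun x hx => ?_
  exact (heq ⟨(le_min hs.1 hr.1).trans hx.1.le, hx.2.trans_le (max_le hs.2 hr.2)⟩).symm

theorem integral_congr_of_eqOn_Ico [NormedSpace ℝ X] {a b : ℝ} {g g' : ℝ → X}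
    (h : EqOn g g' (Ico a b)) {s r : ℝ} (hs : s ∈ Icc a b) (hr : r ∈ Icc a b) :
    ∫ x in s..r, g x = ∫ x in s..r, g' x :=
  intervalIntegral.integral_congr_uIoo fun _ hx =>
    h ⟨(le_min hs.1 hr.1).trans hx.1.le, hx.2.trans_le (max_le hs.2 hr.2)⟩

theorem ContinuousUpTo.add {a b : ℝ} {g g' : ℝ → X} (hg : ContinuousUpTo a b g)
    (hg' : ContinuousUpTo a b g') : ContinuousUpTo a b (fun s => g s + g' s) := by
  obtain ⟨hc, l, hl⟩ := hg
  obtain ⟨hc', l', hl'⟩ := hg'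
  exact ⟨hc.add hc', l + l', hl.add hl'⟩

theorem ContinuousUpTo.congr {a b : ℝ} {g g' : ℝ → X} (hg : ContinuousUpTo a b g) (hab : a < b)
    (h : EqOn g g' (Ico a b)) : ContinuousUpTo a b g' := by
  obtain ⟨hc, l, hl⟩ := hg
  refine ⟨hc.congr h.symm, l, hl.congr' ?_⟩
  filter_upwards [Ico_mem_nhdsLT hab] with s hs using h hs

theorem ContinuousUpTo.continuousOn_integral [NormedSpace ℝ X] {a b : ℝ} {g : ℝ → X}
    (hab : a < b) (hg : ContinuousUpTo a b g) {τ : ℝ} (hτ : τ ∈ Icc a b) :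
    ContinuousOn (fun s => ∫ r in τ..s, g r) (Icc a b) := by
  obtain ⟨g', hg', heq⟩ := hg.exists_continuous hab
  have : Continuous fun s => ∫ r in τ..s, g' r :=
    intervalIntegral.continuous_primitive (fun _ _ => hg'.intervalIntegrable _ _) τ
  exact this.continuousOn.congr fun s hs => integral_congr_of_eqOn_Ico heq hτ hs

/-- A Lipschitz family of functions continuous up to `b`, evaluated along a continuous curve. -/
theorem ContinuousUpTo.comp_lipschitz {X Y : Type*} [NormedAddCommGroup X] [NormedAddCommGroup Y]
    {a b ℓ : ℝ} (hab : a < b) {G : ℝ → Y → X} (hG : ∀ y, ContinuousUpTo a b (fun s => G s y))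
    (hL : ∀ s y y', ‖G s y - G s y'‖ ≤ ℓ * ‖y - y'‖) {u : ℝ → Y}
    (hu : ContinuousOn u (Icc a b)) : ContinuousUpTo a b (fun s => G s (u s)) := by
  have lim : ∀ (l : Filter ℝ) (c : Y) (x : X), Tendsto u l (𝓝 c) →
      Tendsto (fun s => G s c) l (𝓝 x) → Tendsto (fun s => G s (u s)) l (𝓝 x) := by
    intro l c x hl hx
    have h0 : Tendsto (fun s => G s (u s) - G s c) l (𝓝 0) := by
      refine squeeze_zero_norm (fun s => hL s _ _) ?_
      simpa using (tendsto_iff_norm_sub_tendsto_zero.1 hl).const_mul ℓ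
    simpa using h0.add hx
  refine ⟨fun s hs => lim _ _ _ ((hu s (Ico_subset_Icc_self hs)).mono Ico_subset_Icc_self)
    ((hG (u s)).1 s hs), ?_⟩
  obtain ⟨x, hx⟩ := (hG (u b)).2
  refine ⟨x, lim _ (u b) _ ?_ hx⟩
  have : ContinuousWithinAt u (Ico a b) b :=
    (hu b (right_mem_Icc.2 hab.le)).mono Ico_subset_Icc_self
  rwa [ContinuousWithinAt, nhdsWithin_Ico_eq_nhdsLT hab] at this

end PiecewiseContinuous

/-! ### Solutions as integral equations on grid intervals -/

section Solutions

variable {E : Type*} [NormedAddCommGroup E]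
variable {t ζ : ℤ → ℝ} {γ : ℝ → ℝ} {θ : ℝ}

/-- Right-hand sides `F(s, x, y)` which are piecewise continuous in `s` and Lipschitz in
`x` and `y`. -/
structure IsLipRHS (t : ℤ → ℝ) (ℓ m : ℝ) (F : ℝ → E → E → E) : Prop where
  pc : ∀ x y, PiecewiseContinuous t (fun s => F s x y)
  lip : ∀ s x x' y y', ‖F s x y - F s x' y'‖ ≤ ℓ * ‖x - x'‖ + m * ‖y - y'‖

theorem IsLipRHS.continuousUpTo {ℓ m : ℝ} {F : ℝ → E → E → E} (hF : IsLipRHS t ℓ m F) {i : ℤ}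
    (hi : t i < t (i + 1)) {u : ℝ → E} (hu : ContinuousOn u (Icc (t i) (t (i + 1)))) (y : E) :
    ContinuousUpTo (t i) (t (i + 1)) (fun s => F s (u s) y) :=
  ContinuousUpTo.comp_lipschitz hi (G := fun s x => F s x y) (fun x => hF.pc x y i)
    (ℓ := ℓ) (fun s x x' => by simpa using hF.lip s x x' y y) hu

theorem IsLipRHS.piecewiseContinuous {ℓ m : ℝ} {F : ℝ → E → E → E} (hF : IsLipRHS t ℓ m F)
    (h : IsPiecewiseConstArg t ζ γ θ) {u : ℝ → E} (hu : Continuous u) :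
    PiecewiseContinuous t (fun s => F s (u s) (u (γ s))) := fun i =>
  (hF.continuousUpTo (h.lt_succ i) hu.continuousOn (u (ζ i))).congr (h.lt_succ i) fun s hs => by
    simp only [h.arg_eq i s hs]

variable [NormedSpace ℝ E]

theorem IsSolution.sub_eq_integral (h : IsPiecewiseConstArg t ζ γ θ) {F : ℝ → E → E → E}
    [CompleteSpace E] {u : ℝ → E} (hu : IsSolution t γ F u)
    (hpc : PiecewiseContinuous t (fun s => F s (u s) (u (γ s)))) (i : ℤ) {τ s : ℝ}
    (hτ : τ ∈ Icc (t i) (t (i + 1))) (hs : s ∈ Icc (t i) (t (i + 1))) :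
    u s - u τ = ∫ r in τ..s, F r (u r) (u (ζ i)) := by
  have key : ∀ {τ s : ℝ}, τ ∈ Icc (t i) (t (i + 1)) → s ∈ Icc (t i) (t (i + 1)) → τ ≤ s →
      u s - u τ = ∫ r in τ..s, F r (u r) (u (γ r)) := by
    intro τ s hτ hs hle
    refine (intervalIntegral.integral_eq_sub_of_hasDeriv_right_of_le hle hu.1.continuousOn
      (fun x hx => ?_) (ContinuousUpTo.intervalIntegrable (h.lt_succ i) (hpc i) hτ hs)).symm
    exact (hu.2.1 i x ⟨hτ.1.trans_lt hx.1, hx.2.trans_le hs.2⟩).hasDerivWithinAt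
  have hcongr : ∫ r in τ..s, F r (u r) (u (ζ i)) = ∫ r in τ..s, F r (u r) (u (γ r)) :=
    integral_congr_of_eqOn_Ico (fun x hx => by simp only [h.arg_eq i x hx]) hτ hs
  rw [hcongr]
  rcases le_total τ s with hle | hle
  · exact key hτ hs hle
  · rw [intervalIntegral.integral_symm, ← key hs hτ hle, neg_sub]

/-- A continuous extension of the integrand makes `u` one-sidedly differentiable at both ends of
each closed grid interval; differentiability from the two sides of a node then restores continuity
across it. -/
theorem isSolution_of_sub_eq_integral [CompleteSpace E] (h : IsPiecewiseConstArg t ζ γ θ)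
    {F : ℝ → E → E → E} {ℓ m : ℝ} (hF : IsLipRHS t ℓ m F) {u : ℝ → E}
    (hc : ∀ i, ContinuousOn u (Icc (t i) (t (i + 1))))
    (hu : ∀ i, ∀ s ∈ Icc (t i) (t (i + 1)),
      u s - u (t i) = ∫ r in (t i)..s, F r (u r) (u (ζ i))) :
    IsSolution t γ F u := by
  have hd : ∀ i, ∃ g : ℝ → E, EqOn (fun s => F s (u s) (u (γ s))) g (Ico (t i) (t (i + 1))) ∧
      ∀ s ∈ Icc (t i) (t (i + 1)), HasDerivWithinAt u (g s) (Icc (t i) (t (i + 1))) s := by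
    intro i
    obtain ⟨g, hg, heq⟩ :=
      (hF.continuousUpTo (h.lt_succ i) (hc i) (u (ζ i))).exists_continuous (h.lt_succ i)
    refine ⟨g, fun s hs => by simpa only [h.arg_eq i s hs] using heq hs, fun s hs => ?_⟩
    have hder : HasDerivAt (fun s => u (t i) + ∫ r in (t i)..s, g r) (g s) s :=
      (intervalIntegral.integral_hasDerivAt_right (hg.intervalIntegrable _ _)
        (hg.stronglyMeasurableAtFilter _ _) hg.continuousAt).const_add _
    refine hder.hasDerivWithinAt.congr_of_mem (fun x hx => ?_) hs
    rw [← integral_congr_of_eqOn_Ico heq (h.left_mem i) hx, ← hu i x hx]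
    abel
  have hint : ∀ i, ∀ s ∈ Ioo (t i) (t (i + 1)), HasDerivAt u (F s (u s) (u (γ s))) s := by
    intro i s hs
    obtain ⟨g, heq, hg⟩ := hd i
    have := (hg s (Ioo_subset_Icc_self hs)).hasDerivAt (Icc_mem_nhds hs.1 hs.2)
    rwa [← heq (Ioo_subset_Ico_self hs)] at this
  have hright : ∀ i, HasDerivWithinAt u (F (t i) (u (t i)) (u (γ (t i)))) (Ioi (t i)) (t i) := by
    intro i
    obtain ⟨g, heq, hg⟩ := hd i
    have := (hg (t i) (h.left_mem i)).mono_of_mem_nhdsWithin (Icc_mem_nhdsGT (h.lt_succ i))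
    rwa [← heq (left_mem_Ico.2 (h.lt_succ i))] at this
  have hleft : ∀ i, DifferentiableWithinAt ℝ u (Iio (t i)) (t i) := by
    intro i
    obtain ⟨j, rfl⟩ : ∃ j, i = j + 1 := ⟨i - 1, by ring⟩
    obtain ⟨g, -, hg⟩ := hd j
    exact ((hg (t (j + 1)) (h.right_mem j)).mono_of_mem_nhdsWithin
      (Icc_mem_nhdsLT (h.lt_succ j))).differentiableWithinAt
  refine ⟨continuous_iff_continuousAt.2 fun s => ?_, hint, hright, hleft⟩
  obtain ⟨i, hi⟩ := h.exists_mem_Ico s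
  rcases hi.1.lt_or_eq with hlt | rfl
  · exact (hint i s ⟨hlt, hi.2⟩).continuousAt
  · exact continuousAt_iff_continuous_left'_right'.2
      ⟨(hleft i).continuousWithinAt, (hright i).continuousWithinAt⟩

end Solutions

end

section

/-! ### An exponential weight adapted to the delayed argument -/

section Weight

/-- The weight `(c + A) e^{λ x} - A` in the contraction argument on one grid interval. -/
def expWeight (c A lam x : ℝ) : ℝ := (c + A) * Real.exp (lam * x) - A

theorem le_expWeight {c A lam x : ℝ} (hc : 0 < c) (hA : 0 < A) (hl : 0 < lam) (hx : 0 ≤ x) :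
    c ≤ expWeight c A lam x := by
  have : 1 ≤ Real.exp (lam * x) := Real.one_le_exp (by positivity)
  unfold expWeight
  nlinarith

theorem expWeight_mono {c A lam x y : ℝ} (hc : 0 < c) (hA : 0 < A) (hl : 0 < lam) (hxy : x ≤ y) :
    expWeight c A lam x ≤ expWeight c A lam y := by
  unfold expWeight
  gcongr

theorem continuous_expWeight (c A lam τ : ℝ) :
    Continuous fun s : ℝ => expWeight c A lam |s - τ| := by
  unfold expWeight
  fun_prop

/-- The hypothesis is strict, so it survives raising the rate from `ℓ` to `ℓ / k` with `k` slightly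
below `1`. The room left over determines `c`, chosen so that the weight equals `1` at `θ`. -/
theorem exists_expWeight {ℓ m θ : ℝ}
    (h : m / ℓ * (Real.exp (ℓ * θ) - 1) < 1) :
    ∃ k c : ℝ, 0 < k ∧ k < 1 ∧ 0 < c ∧ expWeight c (m / ℓ) (ℓ / k) θ ≤ 1 := by
  have hcont : ContinuousAt (fun k : ℝ => m / ℓ * (Real.exp (ℓ / k * θ) - 1)) 1 := by
    have : ContinuousAt (fun k : ℝ => ℓ / k) 1 := continuousAt_const.div continuousAt_id one_ne_zero
    fun_prop
  have h1 : ∀ᶠ k in 𝓝[<] (1 : ℝ), m / ℓ * (Real.exp (ℓ / k * θ) - 1) < 1 :=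
    nhdsWithin_le_nhds (hcont.eventually_lt continuousAt_const (by simpa using h))
  obtain ⟨k, ⟨hk, hk0⟩, hk1⟩ :=
    ((h1.and (nhdsWithin_le_nhds (lt_mem_nhds one_pos))).and self_mem_nhdsWithin).exists
  have he := Real.exp_pos (ℓ / k * θ)
  refine ⟨k, (1 - m / ℓ * (Real.exp (ℓ / k * θ) - 1)) / Real.exp (ℓ / k * θ), hk0, hk1,
    div_pos (by linarith) he, le_of_eq ?_⟩
  unfold expWeight
  rw [add_mul, div_mul_cancel₀ _ he.ne']
  ring

theorem norm_integral_le_of_norm_le_exp {E : Type*} [NormedAddCommGroup E] [NormedSpace ℝ E]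
    {B lam τ s : ℝ} (hB : 0 ≤ B) (hl : 0 < lam) {G : ℝ → E}
    (hG : ∀ r ∈ uIcc τ s, ‖G r‖ ≤ B * Real.exp (lam * |r - τ|)) :
    ‖∫ r in τ..s, G r‖ ≤ B / lam * (Real.exp (lam * |s - τ|) - 1) := by
  have hcont : Continuous fun r : ℝ => B * Real.exp (lam * |r - τ|) := by fun_prop
  refine (intervalIntegral.norm_integral_le_abs_of_norm_le
    (MeasureTheory.ae_restrict_of_forall_mem measurableSet_uIoc
      fun r hr => hG r (uIoc_subset_uIcc hr)) (hcont.intervalIntegrable _ _)).trans ?_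
  -- `e` is the direction of integration: with `|r - τ| = e (r - τ)` one antiderivative serves both
  -- directions.
  have main : ∀ e : ℝ, (e = 1 ∨ e = -1) → (∀ r ∈ uIcc τ s, |r - τ| = e * (r - τ)) →
      |∫ r in τ..s, B * Real.exp (lam * |r - τ|)| ≤
        B / lam * (Real.exp (lam * |s - τ|) - 1) := by
    intro e he habs
    have h1 : ∫ r in τ..s, B * Real.exp (lam * |r - τ|) =
        e * (B / lam) * (Real.exp (lam * |s - τ|) - 1) := by
      rw [intervalIntegral.integral_congr (g := fun r => B * Real.exp (lam * (e * (r - τ))))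
        (fun r hr => by simp only [habs r hr]), habs s right_mem_uIcc,
        intervalIntegral.integral_eq_sub_of_hasDerivAt
          (f := fun r => e * (B / lam) * Real.exp (lam * (e * (r - τ))))
          (fun r _ => ?_) (Continuous.intervalIntegrable (by fun_prop) _ _)]
      · simp
        ring
      · have h2 : HasDerivAt (fun r => lam * (e * (r - τ))) (lam * (e * 1)) r :=
          (((hasDerivAt_id r).sub_const τ).const_mul e).const_mul lam
        have he2 : e * e = 1 := by rcases he with rfl | rfl <;> norm_num
        refine (h2.exp.const_mul (e * (B / lam))).congr_deriv ?_
        rw [show ∀ x : ℝ, e * (B / lam) * (x * (lam * (e * 1))) = e * e * (B * x) by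
          intro x; field_simp, he2, one_mul]
    have h3 : 0 ≤ Real.exp (lam * |s - τ|) - 1 :=
      sub_nonneg.2 (Real.one_le_exp (by positivity))
    rw [h1, abs_mul, abs_mul, abs_of_nonneg h3, abs_of_nonneg (a := B / lam) (by positivity)]
    rcases he with rfl | rfl <;> simp
  rcases le_total τ s with hle | hle
  · refine main 1 (Or.inl rfl) fun r hr => ?_
    rw [uIcc_of_le hle] at hr
    rw [abs_of_nonneg (sub_nonneg.2 hr.1), one_mul]
  · refine main (-1) (Or.inr rfl) fun r hr => ?_
    rw [uIcc_of_ge hle] at hr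
    rw [abs_of_nonpos (sub_nonpos.2 hr.2), neg_one_mul]

end Weight

/-! ### Growth and existence on one grid interval -/

section Local

variable {E : Type*} [NormedAddCommGroup E] [NormedSpace ℝ E]

/-- The weight `w` solves `k w' = ℓ w + m`, `w(0) = c`, so integrating `ℓ w + m` gives `k (w - c) ≤
k w`. The delayed value at `z` enters only through `w ≤ 1`. -/
theorem norm_integral_le_expWeight {ℓ k c A lam m N a b τ z s : ℝ} (hℓ : 0 < ℓ) (hk : 0 < k)
    (hm : 0 < m) (hc : 0 < c) (hN : 0 ≤ N) (hA : A = m / ℓ) (hlam : lam = ℓ / k)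
    (hw : expWeight c A lam (b - a) ≤ 1) (hτ : τ ∈ Icc a b) (hz : z ∈ Icc a b) (hs : s ∈ Icc a b)
    {G : ℝ → E} (hG : ∀ r ∈ Icc a b, ‖G r‖ ≤
      N * (ℓ * expWeight c A lam |r - τ| + m * expWeight c A lam |z - τ|)) :
    ‖∫ r in τ..s, G r‖ ≤ N * (k * expWeight c A lam |s - τ|) := by
  have hA0 : 0 < A := hA ▸ div_pos hm hℓ
  have hl0 : 0 < lam := hlam ▸ div_pos hℓ hk
  have hz1 : expWeight c A lam |z - τ| ≤ 1 := by
    refine (expWeight_mono hc hA0 hl0 ?_).trans hw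
    rw [abs_le]
    constructor <;> linarith [hz.1, hz.2, hτ.1, hτ.2]
  have hmA : m = ℓ * A := by rw [hA]; field_simp
  have hkl : ℓ / lam = k := by rw [hlam]; field_simp
  have h1 : ‖∫ r in τ..s, G r‖ ≤
      N * (ℓ * (c + A)) / lam * (Real.exp (lam * |s - τ|) - 1) := by
    refine norm_integral_le_of_norm_le_exp (by positivity) hl0 fun r hr => ?_
    refine (hG r (uIcc_subset_Icc hτ hs hr)).trans ?_
    rw [mul_assoc]
    refine mul_le_mul_of_nonneg_left ?_ hN
    have : m * expWeight c A lam |z - τ| ≤ m * 1 := by gcongr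
    calc _ ≤ ℓ * expWeight c A lam |r - τ| + m * 1 := by gcongr
      _ = _ := by rw [hmA]; unfold expWeight; ring
  refine h1.trans ?_
  have h2 : N * (ℓ * (c + A)) / lam = N * (k * (c + A)) := by rw [← hkl]; ring
  rw [h2, mul_assoc, mul_assoc]
  unfold expWeight
  gcongr
  nlinarith

/-- Gronwall-type estimate on one grid interval. -/
theorem exists_local_growth {ℓ m θ : ℝ} (hℓ : 0 < ℓ) (hm : 0 < m)
    (h : m / ℓ * (Real.exp (ℓ * θ) - 1) < 1) :
    ∃ p : ℝ, 0 < p ∧ ∀ {a b τ z : ℝ} {D G : ℝ → E}, b - a ≤ θ → τ ∈ Icc a b → z ∈ Icc a b →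
      ContinuousOn D (Icc a b) → (∀ r ∈ Icc a b, ‖G r‖ ≤ ℓ * ‖D r‖ + m * ‖D z‖) →
      (∀ s ∈ Icc a b, D s - D τ = ∫ r in τ..s, G r) →
      ∀ s ∈ Icc a b, ‖D s‖ ≤ Real.exp (p * |s - τ|) * ‖D τ‖ := by
  obtain ⟨k, c, hk, hk1, hc, hw⟩ := exists_expWeight h
  have hA : 0 < m / ℓ := by positivity
  have hl : 0 < ℓ / k := by positivity
  have hk' : 0 < 1 - k := by linarith
  set C := 1 / (c * (1 - k)) with hC
  have hC0 : 0 < C := by positivity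
  refine ⟨(ℓ + m) * C, by positivity, ?_⟩
  intro a b τ z D G hab hτ hz hD hG hint
  have hab' : a ≤ b := hτ.1.trans hτ.2
  have hwab : expWeight c (m / ℓ) (ℓ / k) (b - a) ≤ 1 := (expWeight_mono hc hA hl hab).trans hw
  set w : ℝ → ℝ := fun s => expWeight c (m / ℓ) (ℓ / k) |s - τ| with hwdef
  have hwc : ∀ s, c ≤ w s := fun s => le_expWeight hc hA hl (abs_nonneg _)
  have hw0 : ∀ s, 0 < w s := fun s => hc.trans_le (hwc s)
  have hw1 : ∀ s ∈ Icc a b, w s ≤ 1 := fun s hs => by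
    refine (expWeight_mono hc hA hl ?_).trans hwab
    rw [abs_le]
    constructor <;> linarith [hs.1, hs.2, hτ.1, hτ.2]
  -- At a maximum of `‖D‖ / w` the integral term is at most `k` times the left side and can be
  -- absorbed; this gives a crude bound with a constant `C`.
  obtain ⟨s₀, hs₀, hmax⟩ := isCompact_Icc.exists_isMaxOn ⟨τ, hτ⟩
    (f := fun s => ‖D s‖ / w s)
    (hD.norm.div (continuous_expWeight _ _ _ _).continuousOn fun s _ => (hw0 s).ne')
  set N := ‖D s₀‖ / w s₀ with hN
  have hN0 : 0 ≤ N := div_nonneg (norm_nonneg _) (hw0 _).le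
  have hDN : ∀ s ∈ Icc a b, ‖D s‖ ≤ N * w s := fun s hs => (div_le_iff₀ (hw0 s)).1 (hmax hs)
  have hI : ‖∫ r in τ..s₀, G r‖ ≤ N * (k * w s₀) := by
    refine norm_integral_le_expWeight hℓ hk hm hc hN0 rfl rfl hwab hτ hz hs₀ fun r hr => ?_
    refine (hG r hr).trans ?_
    have h1 := hDN r hr
    have h2 := hDN z hz
    calc _ ≤ ℓ * (N * w r) + m * (N * w z) := by gcongr
      _ = _ := by ring
  have hNle : N ≤ C * ‖D τ‖ := by
    have h1 : ‖D s₀‖ ≤ ‖D τ‖ + N * (k * w s₀) := by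
      have : D s₀ = D τ + ∫ r in τ..s₀, G r := by rw [← hint s₀ hs₀]; abel
      rw [this]
      exact (norm_add_le _ _).trans (by gcongr)
    have h2 : ‖D s₀‖ = N * w s₀ := by rw [hN, div_mul_cancel₀ _ (hw0 _).ne']
    have h3 : N * c * (1 - k) ≤ ‖D τ‖ := by
      have : N * c * (1 - k) ≤ N * w s₀ * (1 - k) := by
        gcongr
        exact hwc s₀
      nlinarith
    rw [hC, one_div_mul_eq_div, le_div_iff₀ (by positivity)]
    linarith
  have hDC : ∀ s ∈ Icc a b, ‖D s‖ ≤ C * ‖D τ‖ := fun s hs =>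
    (hDN s hs).trans ((mul_le_of_le_one_right hN0 (hw1 s hs)).trans hNle)
  intro s hs
  -- Feeding the crude bound back into the integral equation gives a factor equal to `1` at `s = τ`,
  -- so the estimates chain over many intervals without accumulating constants.
  have h1 : ‖∫ r in τ..s, G r‖ ≤ ((ℓ + m) * (C * ‖D τ‖)) * |s - τ| := by
    refine intervalIntegral.norm_integral_le_of_norm_le_const fun r hr => ?_
    have hr' := uIcc_subset_Icc hτ hs (uIoc_subset_uIcc hr)
    have h2 := hDC r hr'
    have h3 := hDC z hz
    calc _ ≤ _ := hG r hr'
      _ ≤ ℓ * (C * ‖D τ‖) + m * (C * ‖D τ‖) := by gcongr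
      _ = _ := by ring
  have h4 : D s = D τ + ∫ r in τ..s, G r := by rw [← hint s hs]; abel
  calc ‖D s‖ ≤ ‖D τ‖ + ‖∫ r in τ..s, G r‖ := by rw [h4]; exact norm_add_le _ _
    _ ≤ ((ℓ + m) * C * |s - τ| + 1) * ‖D τ‖ := by linarith
    _ ≤ _ := by
      gcongr
      exact Real.add_one_le_exp _

/-- Existence of solutions of `u' = F(s, u(s), u(z))` on one grid interval. -/
theorem exists_local_solution [CompleteSpace E] {ℓ m θ : ℝ} (hℓ : 0 < ℓ) (hm : 0 < m)
    (h : m / ℓ * (Real.exp (ℓ * θ) - 1) < 1) {a b τ z : ℝ} (hlt : a < b) (hab : b - a ≤ θ)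
    (hτ : τ ∈ Icc a b) (hz : z ∈ Icc a b) {F : ℝ → E → E → E}
    (hpc : ∀ x y, ContinuousUpTo a b (fun s => F s x y))
    (hlip : ∀ s x x' y y', ‖F s x y - F s x' y'‖ ≤ ℓ * ‖x - x'‖ + m * ‖y - y'‖) (ξ : E) :
    ∃ u : ℝ → E, ContinuousOn u (Icc a b) ∧
      ∀ s ∈ Icc a b, u s = ξ + ∫ r in τ..s, F r (u r) (u z) := by
  obtain ⟨k, c, hk, hk1, hc, hw⟩ := exists_expWeight h
  have hA : 0 < m / ℓ := by positivity
  have hl : 0 < ℓ / k := by positivity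
  have hwab : expWeight c (m / ℓ) (ℓ / k) (b - a) ≤ 1 := (expWeight_mono hc hA hl hab).trans hw
  set w : ℝ → ℝ := fun s => expWeight c (m / ℓ) (ℓ / k) |s - τ| with hwdef
  have hw0 : ∀ s, 0 < w s := fun s => hc.trans_le (le_expWeight hc hA hl (abs_nonneg _))
  have hwcont : Continuous w := continuous_expWeight _ _ _ _
  -- Substituting `u = w v` turns the weighted sup norm of `u` into the ordinary sup norm of `v`.
  let U : C(Icc a b, E) → ℝ → E := fun v s => w s • IccExtend hlt.le v s
  have hU : ∀ v, Continuous (U v) := fun v => hwcont.smul v.continuous.Icc_extend'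
  have hUI : ∀ v, ContinuousUpTo a b (fun r => F r (U v r) (U v z)) := fun v =>
    ContinuousUpTo.comp_lipschitz hlt (G := fun s x => F s x (U v z)) (fun x => hpc x _)
      (ℓ := ℓ) (fun s x x' => by simpa using hlip s x x' (U v z) (U v z)) (hU v).continuousOn
  let T : C(Icc a b, E) → C(Icc a b, E) := fun v =>
    ⟨fun s => (w s)⁻¹ • (ξ + ∫ r in τ..s, F r (U v r) (U v z)), by
      have h1 : ContinuousOn (fun s => (w s)⁻¹ • (ξ + ∫ r in τ..s, F r (U v r) (U v z)))
          (Icc a b) :=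
        (hwcont.inv₀ fun s => (hw0 s).ne').continuousOn.smul
          (continuousOn_const.add ((hUI v).continuousOn_integral hlt hτ))
      exact h1.domRestrict⟩
  have hT : ContractingWith ⟨k, hk.le⟩ T := by
    refine ⟨hk1, LipschitzWith.of_dist_le_mul fun v v' => ?_⟩
    refine (ContinuousMap.dist_le (by positivity)).2 fun s => ?_
    have hint := (hUI v).intervalIntegrable hlt hτ s.2
    have hint' := (hUI v').intervalIntegrable hlt hτ s.2
    have hd : ∀ r, ‖U v r - U v' r‖ ≤ dist v v' * w r := fun r => by
      simp only [U, IccExtend, Function.comp_apply]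
      rw [← smul_sub, norm_smul, Real.norm_of_nonneg (hw0 r).le, mul_comm, ← dist_eq_norm]
      gcongr
      · exact (hw0 r).le
      · exact ContinuousMap.dist_apply_le_dist _
    have key : ‖∫ r in τ..s, (F r (U v r) (U v z) - F r (U v' r) (U v' z))‖ ≤
        dist v v' * (k * w s) := by
      refine norm_integral_le_expWeight hℓ hk hm hc dist_nonneg rfl rfl hwab hτ hz s.2
        fun r _ => (hlip _ _ _ _ _).trans ?_
      have h1 := hd r
      have h2 := hd z
      calc _ ≤ ℓ * (dist v v' * w r) + m * (dist v v' * w z) := by gcongr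
        _ = _ := by ring
    rw [dist_eq_norm]
    change ‖(w s)⁻¹ • (ξ + ∫ r in τ..s, F r (U v r) (U v z)) -
      (w s)⁻¹ • (ξ + ∫ r in τ..s, F r (U v' r) (U v' z))‖ ≤ k * dist v v'
    rw [← smul_sub, add_sub_add_left_eq_sub, ← intervalIntegral.integral_sub hint hint', norm_smul,
      norm_inv, Real.norm_of_nonneg (hw0 s).le, inv_mul_le_iff₀ (hw0 s)]
    linarith
  obtain ⟨v, hv⟩ : ∃ v, T v = v := ⟨_, hT.fixedPoint_isFixedPt⟩
  refine ⟨U v, (hU v).continuousOn, fun s hs => ?_⟩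
  have h1 : v ⟨s, hs⟩ = (w s)⁻¹ • (ξ + ∫ r in τ..s, F r (U v r) (U v z)) :=
    (congrArg (fun g : C(Icc a b, E) => g ⟨s, hs⟩) hv).symm
  change w s • IccExtend hlt.le v s = _
  rw [IccExtend_of_mem _ _ hs, h1, smul_smul, mul_inv_cancel₀ (hw0 s).ne', one_smul]

end Local

/-! ### Global solutions and exponential growth -/

section Global

/-- A relation on consecutive terms which is total in both directions has a two-sided orbit
through every point. -/
theorem exists_int_orbit {X : Type*} {R : ℤ → X → X → Prop} (hf : ∀ i x, ∃ y, R i x y)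
    (hb : ∀ i y, ∃ x, R i x y) (j : ℤ) (x₀ : X) :
    ∃ v : ℤ → X, v j = x₀ ∧ ∀ i, R i (v i) (v (i + 1)) := by
  choose f hf using hf
  choose g hg using hb
  let a : ℕ → X := fun n => Nat.rec x₀ (fun n x => f (j + n) x) n
  let b : ℕ → X := fun n => Nat.rec x₀ (fun n x => g (j - n - 1) x) n
  refine ⟨fun i => if j ≤ i then a (i - j).toNat else b (j - i).toNat, by simp [a], fun i => ?_⟩
  rcases le_or_gt j i with h | h
  · obtain ⟨n, rfl⟩ := Int.le.dest h
    have e1 : (j + n - j).toNat = n := by omega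
    have e2 : (j + n + 1 - j).toNat = n + 1 := by omega
    simp only [if_pos h, if_pos (show j ≤ j + n + 1 by omega), e1, e2]
    exact hf _ _
  · obtain ⟨n, hn⟩ := Int.le.dest (Int.add_one_le_of_lt h)
    have hi : i = j - n - 1 := by omega
    have e1 : (j - i).toNat = n + 1 := by omega
    have key : R i (b (n + 1)) (b n) := by rw [hi]; exact hg _ _
    simp only [if_neg (not_le.2 h), e1]
    by_cases h' : j ≤ i + 1
    · have : n = 0 := by omega
      subst this
      have e2 : (i + 1 - j).toNat = 0 := by omega
      simpa only [if_pos h', e2] using (show R i (b (0 + 1)) (a 0) from key)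
    · have e2 : (j - (i + 1)).toNat = n := by omega
      simpa only [if_neg h', e2] using key

variable {E : Type*} {t ζ : ℤ → ℝ} {γ : ℝ → ℝ} {θ : ℝ}

/-- `idx` assigns the node `t (i + 1)` to the next piece; the matching condition extends the
agreement to the closed interval. -/
theorem IsPiecewiseConstArg.eqOn_glue (h : IsPiecewiseConstArg t ζ γ θ) {U : ℤ → ℝ → E}
    (hU : ∀ i, U i (t (i + 1)) = U (i + 1) (t (i + 1))) (i : ℤ) :
    EqOn (fun s => U (idx t s) s) (U i) (Icc (t i) (t (i + 1))) := by
  intro s hs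
  rcases hs.2.lt_or_eq with hlt | rfl
  · simp only [h.idx_eq ⟨hs.1, hlt⟩]
  · simp only [h.idx_eq (left_mem_Ico.2 (h.lt_succ (i + 1))), hU i]

variable [NormedAddCommGroup E] [NormedSpace ℝ E]

theorem isSolution_glue [CompleteSpace E] (h : IsPiecewiseConstArg t ζ γ θ) {ℓ m : ℝ}
    {F : ℝ → E → E → E} (hF : IsLipRHS t ℓ m F) {U : ℤ → ℝ → E}
    (hU : ∀ i, U i (t (i + 1)) = U (i + 1) (t (i + 1)))
    (hc : ∀ i, ContinuousOn (U i) (Icc (t i) (t (i + 1))))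
    (hint : ∀ i, ∀ s ∈ Icc (t i) (t (i + 1)),
      U i s - U i (t i) = ∫ r in (t i)..s, F r (U i r) (U i (ζ i))) :
    IsSolution t γ F (fun s => U (idx t s) s) := by
  have hEq : ∀ i, ∀ s ∈ Icc (t i) (t (i + 1)), U (idx t s) s = U i s := h.eqOn_glue hU
  refine isSolution_of_sub_eq_integral h hF (fun i => (hc i).congr (hEq i)) fun i s hs => ?_
  simp only [hEq i _ hs, hEq i _ (h.left_mem i), hEq i _ (h.zeta_mem i), hint i s hs]
  refine integral_congr_of_eqOn_Ico (fun r hr => ?_) (h.left_mem i) hs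
  simp only [hEq i _ (Ico_subset_Icc_self hr)]

/-- Solutions of a Lipschitz system exist for all initial values. -/
theorem exists_solution [CompleteSpace E] (h : IsPiecewiseConstArg t ζ γ θ) {ℓ m : ℝ}
    (hℓ : 0 < ℓ) (hm : 0 < m) (hsmall : m / ℓ * (Real.exp (ℓ * θ) - 1) < 1)
    {F : ℝ → E → E → E} (hF : IsLipRHS t ℓ m F) (τ : ℝ) (ξ : E) :
    ∃ u, IsSolution t γ F u ∧ u τ = ξ := by
  obtain ⟨p, -, hp⟩ := exists_local_growth (E := E) hℓ hm hsmall
  let S : ℤ → (ℝ → E) → Prop := fun i u => ContinuousOn u (Icc (t i) (t (i + 1))) ∧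
    ∀ s ∈ Icc (t i) (t (i + 1)), u s - u (t i) = ∫ r in (t i)..s, F r (u r) (u (ζ i))
  have hint : ∀ i u, ContinuousOn u (Icc (t i) (t (i + 1))) → ∀ s ∈ Icc (t i) (t (i + 1)),
      ∀ r ∈ Icc (t i) (t (i + 1)),
      IntervalIntegrable (fun r => F r (u r) (u (ζ i))) MeasureTheory.volume s r :=
    fun i u hu s hs r hr =>
      (hF.continuousUpTo (h.lt_succ i) hu _).intervalIntegrable (h.lt_succ i) hs hr
  have hloc : ∀ i, ∀ σ ∈ Icc (t i) (t (i + 1)), ∀ η, ∃ u, S i u ∧ u σ = η := by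
    intro i σ hσ η
    obtain ⟨u, hc, hu⟩ := exists_local_solution hℓ hm hsmall (h.lt_succ i) (h.gap_le i) hσ
      (h.zeta_mem i) (fun x y => hF.pc x y i) hF.lip η
    refine ⟨u, ⟨hc, fun s hs => ?_⟩, by simpa using hu σ hσ⟩
    rw [hu s hs, hu _ (h.left_mem i), add_sub_add_left_eq_sub,
      intervalIntegral.integral_interval_sub_left (hint i u hc _ hσ _ hs)
        (hint i u hc _ hσ _ (h.left_mem i))]
  have huniq : ∀ i u u', S i u → S i u' → u (t i) = u' (t i) →
      EqOn u u' (Icc (t i) (t (i + 1))) := by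
    intro i u u' hu hu' heq s hs
    have := hp (D := fun s => u s - u' s)
      (G := fun r => F r (u r) (u (ζ i)) - F r (u' r) (u' (ζ i))) (h.gap_le i) (h.left_mem i)
      (h.zeta_mem i) (hu.1.sub hu'.1) (fun r _ => hF.lip _ _ _ _ _) (fun s hs => by
        rw [intervalIntegral.integral_sub (hint i u hu.1 _ (h.left_mem i) _ hs)
          (hint i u' hu'.1 _ (h.left_mem i) _ hs), ← hu.2 s hs, ← hu'.2 s hs]
        abel) s hs
    simp only [heq, sub_self, norm_zero, mul_zero] at this
    exact sub_eq_zero.1 (norm_le_zero_iff.1 this)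
  obtain ⟨u₀, hu₀, hu₀τ⟩ := hloc (idx t τ) τ (Ico_subset_Icc_self (h.idx_mem τ)) ξ
  -- Solving from the left or from the right end of an interval supplies the forward and the
  -- backward steps of the orbit of node values.
  obtain ⟨v, hv, hR⟩ := exists_int_orbit
    (R := fun i x y => ∃ u, S i u ∧ u (t i) = x ∧ u (t (i + 1)) = y)
    (fun i x => by
      obtain ⟨u, hu, hx⟩ := hloc i _ (h.left_mem i) x
      exact ⟨_, u, hu, hx, rfl⟩)
    (fun i y => by
      obtain ⟨u, hu, hy⟩ := hloc i _ (h.right_mem i) y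
      exact ⟨_, u, hu, rfl, hy⟩) (idx t τ) (u₀ (t (idx t τ)))
  choose U hU hUl hUr using hR
  refine ⟨_, isSolution_glue h hF (U := U) (fun i => by rw [hUr, hUl]) (fun i => (hU i).1)
    (fun i => (hU i).2), ?_⟩
  rw [← hu₀τ]
  exact huniq _ _ _ (hU _) hu₀ (by rw [hUl, hv]) (Ico_subset_Icc_self (h.idx_mem τ))

/-- Exponential bound for the distance between two solutions; in particular solutions are
determined by their value at one point. -/
theorem exists_growth [CompleteSpace E] {ℓ m θ : ℝ} (hℓ : 0 < ℓ) (hm : 0 < m)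
    (hsmall : m / ℓ * (Real.exp (ℓ * θ) - 1) < 1) :
    ∃ p : ℝ, 0 < p ∧ ∀ {t ζ : ℤ → ℝ} {γ : ℝ → ℝ}, IsPiecewiseConstArg t ζ γ θ →
      ∀ {F : ℝ → E → E → E}, IsLipRHS t ℓ m F → ∀ {u u' : ℝ → E}, IsSolution t γ F u →
      IsSolution t γ F u' → ∀ s τ, ‖u s - u' s‖ ≤ Real.exp (p * |s - τ|) * ‖u τ - u' τ‖ := by
  obtain ⟨p, hp0, hp⟩ := exists_local_growth (E := E) hℓ hm hsmall
  refine ⟨p, hp0, ?_⟩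
  intro t ζ γ h F hF u u' hu hu'
  have hloc : ∀ i, ∀ τ ∈ Icc (t i) (t (i + 1)), ∀ s ∈ Icc (t i) (t (i + 1)),
      ‖u s - u' s‖ ≤ Real.exp (p * |s - τ|) * ‖u τ - u' τ‖ := by
    intro i τ hτ
    refine hp (D := fun s => u s - u' s)
      (G := fun r => F r (u r) (u (ζ i)) - F r (u' r) (u' (ζ i))) (h.gap_le i) hτ
      (h.zeta_mem i) (hu.1.sub hu'.1).continuousOn (fun r _ => hF.lip _ _ _ _ _) fun s hs => ?_
    have h1 := (hF.continuousUpTo (h.lt_succ i) hu.1.continuousOn (u (ζ i))).intervalIntegrable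
      (h.lt_succ i) hτ hs
    have h2 := (hF.continuousUpTo (h.lt_succ i) hu'.1.continuousOn (u' (ζ i))).intervalIntegrable
      (h.lt_succ i) hτ hs
    rw [intervalIntegral.integral_sub h1 h2,
      ← hu.sub_eq_integral h (hF.piecewiseContinuous h hu.1) i hτ hs,
      ← hu'.sub_eq_integral h (hF.piecewiseContinuous h hu'.1) i hτ hs]
    abel
  -- Multiplied by `e^{-ps}` the distance decreases, and by `e^{ps}` it increases. Both are local
  -- properties, so they pass from grid intervals to the line.
  have hup : Monotone fun s => -(‖u s - u' s‖ * Real.exp (-(p * s))) := by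
    refine h.monotone_of_monotoneOn fun i a ha b hb hab => neg_le_neg ?_
    have := hloc i a ha b hb
    rw [abs_of_nonneg (sub_nonneg.2 hab)] at this
    calc _ ≤ Real.exp (p * (b - a)) * ‖u a - u' a‖ * Real.exp (-(p * b)) := by gcongr
      _ = ‖u a - u' a‖ * (Real.exp (p * (b - a)) * Real.exp (-(p * b))) := by ring
      _ = _ := by rw [← Real.exp_add]; ring_nf
  have hdown : Monotone fun s => ‖u s - u' s‖ * Real.exp (p * s) := by
    refine h.monotone_of_monotoneOn fun i a ha b hb hab => ?_
    have := hloc i b hb a ha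
    rw [abs_of_nonpos (sub_nonpos.2 hab)] at this
    calc _ ≤ Real.exp (p * -(a - b)) * ‖u b - u' b‖ * Real.exp (p * a) := by gcongr
      _ = ‖u b - u' b‖ * (Real.exp (p * -(a - b)) * Real.exp (p * a)) := by ring
      _ = _ := by rw [← Real.exp_add]; ring_nf
  intro s τ
  rcases le_total τ s with hle | hle
  · have := neg_le_neg_iff.1 (hup hle)
    rw [abs_of_nonneg (sub_nonneg.2 hle)]
    calc ‖u s - u' s‖ = ‖u s - u' s‖ * Real.exp (-(p * s)) * Real.exp (p * s) := by
          rw [mul_assoc, ← Real.exp_add]; simp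
      _ ≤ ‖u τ - u' τ‖ * Real.exp (-(p * τ)) * Real.exp (p * s) := by gcongr
      _ = ‖u τ - u' τ‖ * (Real.exp (-(p * τ)) * Real.exp (p * s)) := by ring
      _ = _ := by rw [← Real.exp_add, mul_comm]; ring_nf
  · have := hdown hle
    simp only at this
    rw [abs_of_nonpos (sub_nonpos.2 hle)]
    calc ‖u s - u' s‖ = ‖u s - u' s‖ * Real.exp (p * s) * Real.exp (-(p * s)) := by
          rw [mul_assoc, ← Real.exp_add]; simp
      _ ≤ ‖u τ - u' τ‖ * Real.exp (p * τ) * Real.exp (-(p * s)) := by gcongr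
      _ = ‖u τ - u' τ‖ * (Real.exp (p * τ) * Real.exp (-(p * s))) := by ring
      _ = _ := by rw [← Real.exp_add, mul_comm]; ring_nf

end Global

end

/-! ### Transition operator and variation of parameters -/

section

variable {E : Type*} [NormedAddCommGroup E] [NormedSpace ℝ E]
variable {t ζ : ℤ → ℝ} {γ : ℝ → ℝ} {θ : ℝ} {A₀ : ℝ → E →L[ℝ] E} {M₀ ℓ m : ℝ}

/-- A piecewise continuous bounded coefficient on a grid which is fine enough for the initial
value problem of a perturbation with Lipschitz constants `ℓ` and `m - M₀` to be well posed. -/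
structure IsAdmissible (t ζ : ℤ → ℝ) (γ : ℝ → ℝ) (θ : ℝ) (A₀ : ℝ → E →L[ℝ] E) (M₀ ℓ m : ℝ) :
    Prop where
  arg : IsPiecewiseConstArg t ζ γ θ
  pc : PiecewiseContinuous t A₀
  bound : ∀ s, ‖A₀ s‖ ≤ M₀
  M₀_pos : 0 < M₀
  M₀_le : M₀ ≤ m
  ℓ_pos : 0 < ℓ
  small : m / ℓ * (Real.exp (ℓ * θ) - 1) < 1
  small_lin : m * θ < 1

theorem IsAdmissible.m_pos (H : IsAdmissible t ζ γ θ A₀ M₀ ℓ m) : 0 < m :=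
  H.M₀_pos.trans_le H.M₀_le

theorem IsAdmissible.pc_apply (H : IsAdmissible t ζ γ θ A₀ M₀ ℓ m) (y : E) :
    PiecewiseContinuous t (fun s => A₀ s y) := fun i => by
  obtain ⟨hc, l, hl⟩ := H.pc i
  exact ⟨hc.clm_apply continuousOn_const, l y,
    ((ContinuousLinearMap.apply ℝ E y).continuous.tendsto l).comp hl⟩

/-- The same constants `ℓ`, `m` serve the linear, the inhomogeneous and the nonlinear system, so one
well-posedness theory covers all three. -/
theorem IsAdmissible.isLipRHS_quasiRHS (H : IsAdmissible t ζ γ θ A₀ M₀ ℓ m) {ℓ₂ : ℝ}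
    (hm : M₀ + ℓ₂ ≤ m) {f : ℝ → E → E → E}
    (hfc : ∀ x y, PiecewiseContinuous t (fun s => f s x y))
    (hfL : ∀ s x x' y y', ‖f s x y - f s x' y'‖ ≤ ℓ * ‖x - x'‖ + ℓ₂ * ‖y - y'‖) :
    IsLipRHS t ℓ m (quasiRHS A₀ f) where
  pc x y i := ContinuousUpTo.add (H.pc_apply y i) (hfc x y i)
  lip s x x' y y' := by
    have h1 : ‖A₀ s (y - y')‖ ≤ M₀ * ‖y - y'‖ := (A₀ s).le_of_opNorm_le (H.bound s) _
    have h2 := hfL s x x' y y'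
    have h3 := mul_le_mul_of_nonneg_right hm (norm_nonneg (y - y'))
    have e : quasiRHS A₀ f s x y - quasiRHS A₀ f s x' y' =
        A₀ s (y - y') + (f s x y - f s x' y') := by
      simp only [quasiRHS, map_sub]; abel
    rw [e]
    linarith [norm_add_le (A₀ s (y - y')) (f s x y - f s x' y')]

theorem IsAdmissible.isLipRHS_inhom (H : IsAdmissible t ζ γ θ A₀ M₀ ℓ m) {g : ℝ → E}
    (hg : PiecewiseContinuous t g) : IsLipRHS t ℓ m (quasiRHS A₀ (fun s _ _ => g s)) :=
  H.isLipRHS_quasiRHS (ℓ₂ := 0) (by simpa using H.M₀_le) (fun _ _ => hg) fun s x x' y y' => by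
    have := H.ℓ_pos
    simp only [sub_self, norm_zero, zero_mul, add_zero]
    positivity

theorem linRHS_eq_quasiRHS : linRHS A₀ = quasiRHS A₀ (fun _ _ _ => 0) := by
  funext s x y
  simp [linRHS, quasiRHS]

theorem piecewiseContinuous_const {X : Type*} [TopologicalSpace X] (x : X) :
    PiecewiseContinuous t (fun _ => x) := fun _ =>
  ⟨continuousOn_const, x, tendsto_const_nhds⟩

theorem IsAdmissible.isLipRHS_linRHS (H : IsAdmissible t ζ γ θ A₀ M₀ ℓ m) :
    IsLipRHS t ℓ m (linRHS A₀) :=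
  linRHS_eq_quasiRHS (A₀ := A₀) ▸ H.isLipRHS_inhom (piecewiseContinuous_const 0)

theorem evol_self (s : ℝ) : evol A₀ s s = 1 := by simp [evol]

theorem IsAdmissible.evol_sub_apply (H : IsAdmissible t ζ γ θ A₀ M₀ ℓ m) {i : ℤ} {s r z : ℝ}
    (hs : s ∈ Icc (t i) (t (i + 1))) (hr : r ∈ Icc (t i) (t (i + 1)))
    (hz : z ∈ Icc (t i) (t (i + 1))) (c : E) :
    evol A₀ s z c - evol A₀ r z c = ∫ x in r..s, A₀ x c := by
  have hi : ∀ {a b}, a ∈ Icc (t i) (t (i + 1)) → b ∈ Icc (t i) (t (i + 1)) →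
      IntervalIntegrable A₀ MeasureTheory.volume a b := fun ha hb =>
    ContinuousUpTo.intervalIntegrable (H.arg.lt_succ i) (H.pc i) ha hb
  rw [← sub_apply, evol, evol, add_sub_add_left_eq_sub,
    intervalIntegral.integral_interval_sub_left (hi hz hs) (hi hz hr),
    ContinuousLinearMap.intervalIntegral_apply (hi hr hs)]

theorem IsAdmissible.continuousOn_evol_apply (H : IsAdmissible t ζ γ θ A₀ M₀ ℓ m) {i : ℤ} {z : ℝ}
    (hz : z ∈ Icc (t i) (t (i + 1))) (c : E) :
    ContinuousOn (fun s => evol A₀ s z c) (Icc (t i) (t (i + 1))) := by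
  have : ContinuousOn (fun s => evol A₀ s z) (Icc (t i) (t (i + 1))) :=
    continuousOn_const.add (ContinuousUpTo.continuousOn_integral (H.arg.lt_succ i) (H.pc i) hz)
  exact this.clm_apply continuousOn_const

section

variable [CompleteSpace E]

/-- Neumann series: the integral has norm at most `M₀ θ ≤ m θ < 1`. -/
theorem IsAdmissible.isUnit_evol (H : IsAdmissible t ζ γ θ A₀ M₀ ℓ m) {i : ℤ} {s r : ℝ}
    (hs : s ∈ Icc (t i) (t (i + 1))) (hr : r ∈ Icc (t i) (t (i + 1))) :
    IsUnit (evol A₀ s r) := by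
  have h1 : ‖∫ x in r..s, A₀ x‖ ≤ M₀ * |s - r| :=
    intervalIntegral.norm_integral_le_of_norm_le_const fun x _ => H.bound x
  have h2 : ‖∫ x in r..s, A₀ x‖ < 1 := by
    have := H.arg.abs_sub_le hs hr
    have := H.M₀_pos
    have := H.m_pos
    have := H.M₀_le
    have := H.arg.theta_pos
    calc _ ≤ M₀ * |s - r| := h1
      _ ≤ m * θ := by gcongr
      _ < 1 := H.small_lin
  have := isUnit_one_sub_of_norm_lt_one (x := -∫ x in r..s, A₀ x) (by rwa [norm_neg])
  rwa [sub_neg_eq_add] at this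

/-- On one grid interval `A₀` acts on the fixed vector `w (ζ i)`, so a single integration solves the
equation. -/
theorem IsAdmissible.inhom_eq_evol (H : IsAdmissible t ζ γ θ A₀ M₀ ℓ m) {g : ℝ → E}
    (hg : PiecewiseContinuous t g) {w : ℝ → E}
    (hw : IsSolution t γ (quasiRHS A₀ (fun s _ _ => g s)) w) {i : ℤ} {s : ℝ}
    (hs : s ∈ Icc (t i) (t (i + 1))) :
    w s = evol A₀ s (ζ i) (w (ζ i)) + ∫ r in (ζ i)..s, g r := by
  have hz := H.arg.zeta_mem i
  have h1 := hw.sub_eq_integral H.arg ((H.isLipRHS_inhom hg).piecewiseContinuous H.arg hw.1) i hz hs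
  have h2 := H.evol_sub_apply hs hz hz (w (ζ i))
  have hgi := ContinuousUpTo.intervalIntegrable (H.arg.lt_succ i) (hg i) hz hs
  have hAi : IntervalIntegrable (fun r => A₀ r (w (ζ i))) MeasureTheory.volume (ζ i) s :=
    ContinuousUpTo.intervalIntegrable (H.arg.lt_succ i) (H.pc_apply _ i) hz hs
  simp only [quasiRHS] at h1
  rw [intervalIntegral.integral_add hAi hgi, ← h2, evol_self, one_apply_eq_self] at h1
  rw [eq_add_of_sub_eq h1]
  abel

theorem IsAdmissible.lin_eq_evol (H : IsAdmissible t ζ γ θ A₀ M₀ ℓ m) {w : ℝ → E}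
    (hw : IsSolution t γ (linRHS A₀) w) {i : ℤ} {s : ℝ}
    (hs : s ∈ Icc (t i) (t (i + 1))) : w s = evol A₀ s (ζ i) (w (ζ i)) := by
  rw [linRHS_eq_quasiRHS] at hw
  simpa using H.inhom_eq_evol (piecewiseContinuous_const 0) hw hs

/-- Below `i` the transition is built from backward steps; the recursion holds there because
`stepFwd` inverts `stepBwd`. -/
theorem IsAdmissible.gridTransition_succ (H : IsAdmissible t ζ γ θ A₀ M₀ ℓ m) (i j : ℤ) :
    gridTransition A₀ t ζ i (j + 1) = stepFwd A₀ t ζ j * gridTransition A₀ t ζ i j := by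
  unfold gridTransition
  rcases le_or_gt i j with h | h
  · obtain ⟨n, rfl⟩ := Int.le.dest h
    have e1 : (i + n - i).toNat = n := by omega
    have e2 : (i + n + 1 - i).toNat = n + 1 := by omega
    rw [if_pos h, if_pos (by omega), e1, e2, prodFwd]
  · obtain ⟨n, hn⟩ := Int.le.dest (Int.add_one_le_of_lt h)
    have hj : i - n - 1 = j := by omega
    have e1 : (i - j).toNat = n + 1 := by omega
    have hone : stepFwd A₀ t ζ j * stepBwd A₀ t ζ j = 1 := by
      have h1 := H.isUnit_evol (H.arg.left_mem j) (H.arg.zeta_mem j)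
      have h2 := H.isUnit_evol (H.arg.right_mem j) (H.arg.zeta_mem j)
      rw [stepFwd, stepBwd, mul_assoc, ← mul_assoc (Ring.inverse _) (evol _ _ _),
        Ring.inverse_mul_cancel _ h1, one_mul, Ring.mul_inverse_cancel _ h2]
    rw [if_neg (not_le.2 h), e1, prodBwd, hj, ← mul_assoc, hone, one_mul]
    split_ifs with h'
    · have e2 : (j + 1 - i).toNat = 0 := by omega
      have e3 : n = 0 := by omega
      rw [e2, e3, prodFwd, prodBwd]
    · have e2 : (i - (j + 1)).toNat = n := by omega
      rw [e2]

theorem IsAdmissible.isSolution_transition (H : IsAdmissible t ζ γ θ A₀ M₀ ℓ m) (τ : ℝ) (ξ : E) :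
    IsSolution t γ (linRHS A₀) (fun s => transition A₀ t ζ s τ ξ) := by
  have hu := fun j => H.isUnit_evol (H.arg.left_mem j) (H.arg.zeta_mem j)
  -- The formula for `transition` with the index of the running time frozen at `j`: on each piece it
  -- is `evol` applied to a fixed vector.
  let U : ℤ → ℝ → E := fun j s => ((evol A₀ s (ζ j) * Ring.inverse (evol A₀ (t j) (ζ j))) *
    gridTransition A₀ t ζ (idx t τ) j *
    (evol A₀ (t (idx t τ)) (ζ (idx t τ)) * Ring.inverse (evol A₀ τ (ζ (idx t τ))))) ξ
  have hUe : ∀ j s, U j s = evol A₀ s (ζ j) (U j (ζ j)) := fun j s => by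
    simp only [U, evol_self, mul_assoc, mul_apply_eq_comp, one_apply_eq_self]
  refine isSolution_glue H.arg H.isLipRHS_linRHS (U := U) (fun j => ?_) (fun j => ?_)
    fun j s hs => ?_
  · simp only [U]
    rw [H.gridTransition_succ, Ring.mul_inverse_cancel _ (hu (j + 1)), one_mul, stepFwd]
  · exact (H.continuousOn_evol_apply (H.arg.zeta_mem j) (U j (ζ j))).congr fun s _ => hUe j s
  · rw [hUe j s, hUe j (t j), H.evol_sub_apply hs (H.arg.left_mem j) (H.arg.zeta_mem j)]
    rfl

theorem IsAdmissible.transition_self (H : IsAdmissible t ζ γ θ A₀ M₀ ℓ m) (τ : ℝ) :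
    transition A₀ t ζ τ τ = 1 := by
  have hi := H.arg.idx_mem τ
  have h1 := H.isUnit_evol (H.arg.left_mem (idx t τ)) (H.arg.zeta_mem _)
  have h2 := H.isUnit_evol (Ico_subset_Icc_self hi) (H.arg.zeta_mem _)
  have h3 : gridTransition A₀ t ζ (idx t τ) (idx t τ) = 1 := by
    simp [gridTransition, prodFwd]
  rw [transition, h3, mul_one, mul_assoc, ← mul_assoc (Ring.inverse _) (evol _ _ _),
    Ring.inverse_mul_cancel _ h1, one_mul, Ring.mul_inverse_cancel _ h2]

theorem IsAdmissible.solution_unique (H : IsAdmissible t ζ γ θ A₀ M₀ ℓ m) {F : ℝ → E → E → E}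
    (hF : IsLipRHS t ℓ m F) {u u' : ℝ → E} (hu : IsSolution t γ F u) (hu' : IsSolution t γ F u')
    {τ : ℝ} (h : u τ = u' τ) : u = u' := by
  obtain ⟨p, -, hp⟩ := exists_growth (E := E) H.ℓ_pos H.m_pos H.small
  funext s
  have := hp H.arg hF hu hu' s τ
  simp only [h, sub_self, norm_zero, mul_zero] at this
  exact sub_eq_zero.1 (norm_le_zero_iff.1 this)

/-- Uniqueness replaces any computation with grid products; the cocycle law is then a special case.
-/
theorem IsAdmissible.lin_eq_transition (H : IsAdmissible t ζ γ θ A₀ M₀ ℓ m) {u : ℝ → E}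
    (hu : IsSolution t γ (linRHS A₀) u) (s τ : ℝ) : transition A₀ t ζ s τ (u τ) = u s :=
  congrFun (H.solution_unique H.isLipRHS_linRHS (H.isSolution_transition τ (u τ)) hu (τ := τ)
    (by rw [H.transition_self, one_apply_eq_self])) s

theorem IsAdmissible.transition_transition (H : IsAdmissible t ζ γ θ A₀ M₀ ℓ m) (s r τ : ℝ)
    (ξ : E) : transition A₀ t ζ s r (transition A₀ t ζ r τ ξ) = transition A₀ t ζ s τ ξ :=
  H.lin_eq_transition (H.isSolution_transition τ ξ) s r

/-- Variation of parameters within one grid interval. -/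
theorem IsAdmissible.transition_sub_integral (H : IsAdmissible t ζ γ θ A₀ M₀ ℓ m) {g : ℝ → E}
    (hg : PiecewiseContinuous t g) {w : ℝ → E}
    (hw : IsSolution t γ (quasiRHS A₀ (fun s _ _ => g s)) w) {i : ℤ} {s r : ℝ}
    (hs : s ∈ Icc (t i) (t (i + 1))) (hr : r ∈ Icc (t i) (t (i + 1))) (σ : ℝ) :
    transition A₀ t ζ σ s (w s - ∫ x in (ζ i)..s, g x) =
      transition A₀ t ζ σ r (w r - ∫ x in (ζ i)..r, g x) := by
  -- What remains after subtracting the integral is `evol` applied to `w (ζ i)`, which on this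
  -- interval is a homogeneous solution; injectivity of `evol` identifies its value at `ζ i`.
  have key : transition A₀ t ζ s r (w r - ∫ x in (ζ i)..r, g x) = w s - ∫ x in (ζ i)..s, g x := by
    have hy := H.isSolution_transition r (w r - ∫ x in (ζ i)..r, g x)
    have h1 := H.lin_eq_evol hy hr
    simp only [H.transition_self, one_apply_eq_self] at h1
    have h2 := H.inhom_eq_evol hg hw hr
    have h3 := (ContinuousLinearMap.isUnit_iff_bijective.1
      (H.isUnit_evol hr (H.arg.zeta_mem i))).1 (h1.symm.trans (sub_eq_of_eq_add h2))
    rw [H.lin_eq_evol hy hs, h3]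
    exact (sub_eq_of_eq_add (H.inhom_eq_evol hg hw hs)).symm
  rw [← key, H.transition_transition]

end

end

section

/-! ### Elementary exponential inequalities -/

section Numeric

/-- Convexity of `exp`, compared at `-p` with its chord over `[-b, 0]`. -/
theorem mul_one_sub_exp_neg_le {b p : ℝ} (hb : 0 < b) (hp : 0 ≤ p) (hpb : p ≤ b) :
    p * (1 - Real.exp (-b)) ≤ b * (1 - Real.exp (-p)) := by
  have h := convexOn_exp.2 (mem_univ (0 : ℝ)) (mem_univ (-b))
    (sub_nonneg.2 ((div_le_one hb).2 hpb)) (div_nonneg hp hb.le) (by ring)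
  simp only [smul_eq_mul, mul_zero, zero_add, Real.exp_zero, mul_one] at h
  rw [show p / b * -b = -p by field_simp] at h
  have h2 := mul_le_mul_of_nonneg_left h hb.le
  have h3 : b * (1 - p / b + p / b * Real.exp (-b)) = b - p + p * Real.exp (-b) := by field_simp
  nlinarith

/-- The ratio between the length of an interval and the integral of `e^{-x}` over it. -/
def expRatio (b : ℝ) : ℝ := b / (1 - Real.exp (-b))

theorem one_sub_exp_neg_pos {b : ℝ} (hb : 0 < b) : 0 < 1 - Real.exp (-b) :=
  sub_pos.2 (Real.exp_lt_one_iff.2 (by linarith))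

theorem one_le_expRatio {b : ℝ} (hb : 0 < b) : 1 ≤ expRatio b := by
  rw [expRatio, one_le_div (one_sub_exp_neg_pos hb)]
  linarith [Real.add_one_le_exp (-b)]

theorem le_expRatio_mul {b p : ℝ} (hb : 0 < b) (hp : 0 ≤ p) (hpb : p ≤ b) :
    p ≤ expRatio b * (1 - Real.exp (-p)) := by
  rw [expRatio, div_mul_eq_mul_div, le_div_iff₀ (one_sub_exp_neg_pos hb)]
  exact mul_one_sub_exp_neg_le hb hp hpb

/-- Clearing denominators leaves `3b e^b - b ≤ 2e^{2b} - 2e^b`, which follows from `1 + b + b²/2 ≤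
e^b` and `(1 - b) e^b ≤ 1`. -/
theorem two_mul_expRatio_add_le {b : ℝ} (hb : 0 < b) :
    2 * expRatio b + b ≤ 2 * Real.exp b := by
  have h0 := one_sub_exp_neg_pos hb
  have he : Real.exp b * Real.exp (-b) = 1 := by rw [← Real.exp_add]; simp
  have hq : 1 + b + b ^ 2 / 2 ≤ Real.exp b := Real.quadratic_le_exp_of_nonneg hb.le
  have h1 : (1 - b) * Real.exp b ≤ 1 := by
    have := mul_le_mul_of_nonneg_left (Real.add_one_le_exp (-b)) (Real.exp_pos b).le
    nlinarith
  have hE := Real.exp_pos b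
  have key : 2 * b + b * (1 - Real.exp (-b)) ≤ 2 * Real.exp b * (1 - Real.exp (-b)) := by
    refine le_of_mul_le_mul_left ?_ hE
    have e1 : Real.exp b * (2 * b + b * (1 - Real.exp (-b))) = 3 * b * Real.exp b - b := by
      linear_combination (-b) * he
    have e2 : Real.exp b * (2 * Real.exp b * (1 - Real.exp (-b))) =
        2 * Real.exp b * Real.exp b - 2 * Real.exp b := by
      linear_combination (-2 * Real.exp b) * he
    rw [e1, e2]
    nlinarith [mul_le_mul_of_nonneg_left hq hE.le, mul_le_mul_of_nonneg_left h1 hb.le]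
  have h2 : expRatio b * (1 - Real.exp (-b)) = b := div_mul_cancel₀ _ h0.ne'
  refine le_of_mul_le_mul_right ?_ h0
  rw [add_mul, mul_assoc 2 (expRatio b), h2]
  exact key

theorem green_bound_aux {b p q : ℝ} (hb : 0 < b) (hp : 0 ≤ p) (hq : 0 ≤ q) (hpq : p + q ≤ b) :
    p + Real.exp (-q) * (p + q) + expRatio b * (Real.exp (-p) + Real.exp (-q)) ≤
      2 * Real.exp b := by
  have hr := one_le_expRatio hb
  have h1 := le_expRatio_mul hb hp (by linarith)
  have h2 : Real.exp (-q) * (expRatio b + p + q) ≤ expRatio b + p := by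
    have h3 : expRatio b + p + q ≤ (expRatio b + p) * Real.exp q := by
      nlinarith [Real.add_one_le_exp q]
    calc _ ≤ Real.exp (-q) * ((expRatio b + p) * Real.exp q) := by gcongr
      _ = (expRatio b + p) * (Real.exp (-q) * Real.exp q) := by ring
      _ = _ := by rw [← Real.exp_add]; simp
  have h4 := two_mul_expRatio_add_le hb
  nlinarith

/-- After scaling, `p` and `q` are the distances from `s` to the two nodes around it and `x` locates
`ζ`. The left side is nonincreasing in `x` up to `p` and nondecreasing after it, so the worst cases
are `x = 0` and `x = p + q`, which are exchanged by swapping `p` and `q`. -/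
theorem green_bound {b p q x : ℝ} (hb : 0 < b) (hp : 0 ≤ p) (hq : 0 ≤ q) (hpq : p + q ≤ b)
    (hx : 0 ≤ x) (hxpq : x ≤ p + q) :
    |p - x| + Real.exp (-p) * x + Real.exp (-q) * (p + q - x) +
      expRatio b * (Real.exp (-p) + Real.exp (-q)) ≤ 2 * Real.exp b := by
  have hep : Real.exp (-p) ≤ 1 := Real.exp_le_one_iff.2 (by linarith)
  have heq : Real.exp (-q) ≤ 1 := Real.exp_le_one_iff.2 (by linarith)
  rcases le_total x p with h | h
  · rw [abs_of_nonneg (sub_nonneg.2 h)]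
    nlinarith [green_bound_aux hb hp hq hpq, Real.exp_pos (-q)]
  · rw [abs_of_nonpos (sub_nonpos.2 h)]
    nlinarith [green_bound_aux hb hq hp (by linarith), Real.exp_pos (-p)]

end Numeric

/-! ### The a priori estimate from the dichotomy -/

variable {E : Type*} [NormedAddCommGroup E] [NormedSpace ℝ E]
variable {t ζ : ℤ → ℝ} {γ : ℝ → ℝ} {θ : ℝ} {A₀ : ℝ → E →L[ℝ] E} {M₀ ℓ m : ℝ}
variable {P : E →L[ℝ] E} {K α : ℝ}

/-- `P` is the projection of an `α`-exponential dichotomy with constant `K`. -/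
structure IsDichotomyProj (A₀ : ℝ → E →L[ℝ] E) (t ζ : ℤ → ℝ) (P : E →L[ℝ] E) (K α : ℝ) :
    Prop where
  one_le : 1 ≤ K
  pos : 0 < α
  idem : P * P = P
  bound : ∀ s r, ‖transitionProj A₀ t ζ P s r‖ ≤ K * Real.exp (-α * |s - r|)

theorem IsDichotomyProj.apply_apply (hP : IsDichotomyProj A₀ t ζ P K α) (x : E) :
    P (P x) = P x := by
  rw [← mul_apply_eq_comp, hP.idem]

theorem IsDichotomyProj.norm_stable_le (hP : IsDichotomyProj A₀ t ζ P K α) {s r : ℝ} (h : r ≤ s)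
    (x : E) : ‖transition A₀ t ζ s 0 (P (transition A₀ t ζ 0 r x))‖ ≤
      K * Real.exp (-(α * (s - r))) * ‖x‖ := by
  have := (transitionProj A₀ t ζ P s r).le_of_opNorm_le (hP.bound s r) x
  rw [transitionProj, if_pos h, abs_of_nonneg (sub_nonneg.2 h)] at this
  simpa [mul_apply_eq_comp] using this

theorem IsDichotomyProj.norm_unstable_le (hP : IsDichotomyProj A₀ t ζ P K α) {s r : ℝ}
    (h : s < r) (x : E) :
    ‖transition A₀ t ζ s 0 (transition A₀ t ζ 0 r x - P (transition A₀ t ζ 0 r x))‖ ≤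
      K * Real.exp (-(α * (r - s))) * ‖x‖ := by
  have := (transitionProj A₀ t ζ P s r).le_of_opNorm_le (hP.bound s r) x
  rw [transitionProj, if_neg (not_le.2 h), abs_of_neg (sub_neg.2 h), neg_sub] at this
  rw [map_sub, norm_sub_rev]
  simpa [mul_apply_eq_comp] using this

/-- The contribution of the inhomogeneity on the `i`-th grid interval, transported to time `0`. -/
def jump (A₀ : ℝ → E →L[ℝ] E) (t ζ : ℤ → ℝ) (g : ℝ → E) (i : ℤ) : E :=
  transition A₀ t ζ 0 (t i) (∫ r in (t i)..(ζ i), g r) +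
    transition A₀ t ζ 0 (t (i + 1)) (∫ r in (ζ i)..(t (i + 1)), g r)

theorem IsPiecewiseConstArg.norm_integral_left_le (h : IsPiecewiseConstArg t ζ γ θ) {g : ℝ → E}
    {B : ℝ} {i : ℤ} (hg : ∀ r ∈ Icc (t i) (t (i + 1)), ‖g r‖ ≤ B) :
    ‖∫ r in (t i)..(ζ i), g r‖ ≤ B * (ζ i - t i) := by
  have := intervalIntegral.norm_integral_le_of_norm_le_const (f := g) (a := t i) (b := ζ i)
    fun r hr => hg r (uIcc_subset_Icc (h.left_mem i) (h.zeta_mem i) (uIoc_subset_uIcc hr))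
  rwa [abs_of_nonneg (sub_nonneg.2 (h.le_zeta i))] at this

theorem IsPiecewiseConstArg.norm_integral_right_le (h : IsPiecewiseConstArg t ζ γ θ) {g : ℝ → E}
    {B : ℝ} {i : ℤ} (hg : ∀ r ∈ Icc (t i) (t (i + 1)), ‖g r‖ ≤ B) :
    ‖∫ r in (ζ i)..(t (i + 1)), g r‖ ≤ B * (t (i + 1) - ζ i) := by
  have := intervalIntegral.norm_integral_le_of_norm_le_const (f := g) (a := ζ i) (b := t (i + 1))
    fun r hr => hg r (uIcc_subset_Icc (h.zeta_mem i) (h.right_mem i) (uIoc_subset_uIcc hr))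
  rwa [abs_of_nonneg (sub_nonneg.2 (h.zeta_le i))] at this

/-- A rectangle of width `d` is compared with the integral of `e^{-βx}` over `[y, y + d]`; the ratio
is largest at `d = θ`. The right side telescopes along the grid. -/
theorem gap_mul_exp_le {β θ d y : ℝ} (hβ : 0 < β) (hθ : 0 < θ) (hd : 0 ≤ d) (hdθ : d ≤ θ) :
    d * Real.exp (-(β * y)) ≤
      expRatio (β * θ) / β * (Real.exp (-(β * y)) - Real.exp (-(β * (y + d)))) := by
  have h := le_expRatio_mul (mul_pos hβ hθ) (mul_nonneg hβ.le hd)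
    (mul_le_mul_of_nonneg_left hdθ hβ.le)
  have e : Real.exp (-(β * (y + d))) = Real.exp (-(β * y)) * Real.exp (-(β * d)) := by
    rw [← Real.exp_add]; ring_nf
  have hd' : d ≤ expRatio (β * θ) / β * (1 - Real.exp (-(β * d))) := by
    rw [div_mul_eq_mul_div, le_div_iff₀ hβ]
    linarith
  rw [e]
  have := mul_le_mul_of_nonneg_right hd' (Real.exp_pos (-(β * y))).le
  linarith

/-- The dichotomy bound and the bound on `g` are both evaluated at `t (i + 1)`, the node nearest to
`s`. For `g` this costs the factor `e^{εθ}`; the product decays at rate `α - ε` and is then made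
telescoping. -/
theorem IsDichotomyProj.norm_stable_jump_le (hP : IsDichotomyProj A₀ t ζ P K α)
    (h : IsPiecewiseConstArg t ζ γ θ) {g : ℝ → E} {ε D s : ℝ} (hε : 0 ≤ ε) (hεα : ε < α)
    (hD : 0 ≤ D) (hg : ∀ r, ‖g r‖ ≤ D * Real.exp (ε * |r - s|)) {i : ℤ} (hi : t (i + 1) ≤ s) :
    ‖transition A₀ t ζ s 0 (P (jump A₀ t ζ g i))‖ ≤
      K * (D * Real.exp (ε * θ)) * (expRatio ((α - ε) * θ) / (α - ε) *
        (Real.exp (-((α - ε) * (s - t (i + 1)))) - Real.exp (-((α - ε) * (s - t i))))) := by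
  have hlt := h.lt_succ i
  have hgap := h.gap_le i
  have hK := hP.one_le
  have hα := hP.pos
  have hB : ∀ r ∈ Icc (t i) (t (i + 1)),
      ‖g r‖ ≤ D * Real.exp (ε * θ) * Real.exp (ε * (s - t (i + 1))) := fun r hr => by
    refine (hg r).trans ?_
    rw [mul_assoc, ← Real.exp_add, ← mul_add, abs_of_nonpos (by linarith [hr.2])]
    gcongr
    linarith [hr.1]
  have ha := h.norm_integral_left_le hB
  have hb := h.norm_integral_right_le hB
  set B := D * Real.exp (ε * θ) * Real.exp (ε * (s - t (i + 1))) with hBdef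
  have h1 := hP.norm_stable_le (hlt.le.trans hi) (∫ r in (t i)..(ζ i), g r)
  have h2 := hP.norm_stable_le hi (∫ r in (ζ i)..(t (i + 1)), g r)
  have h3 : Real.exp (-(α * (s - t i))) ≤ Real.exp (-(α * (s - t (i + 1)))) := by gcongr
  have h4 := gap_mul_exp_le (β := α - ε) (y := s - t (i + 1)) (sub_pos.2 hεα) h.theta_pos
    (sub_nonneg.2 hlt.le) hgap
  rw [sub_add_sub_cancel] at h4
  rw [jump, map_add, map_add]
  calc _ ≤ _ := norm_add_le _ _
    _ ≤ K * Real.exp (-(α * (s - t (i + 1)))) * (B * (ζ i - t i)) +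
        K * Real.exp (-(α * (s - t (i + 1)))) * (B * (t (i + 1) - ζ i)) := by
      refine add_le_add (h1.trans ?_) (h2.trans ?_) <;> gcongr
    _ = K * (D * Real.exp (ε * θ)) * ((t (i + 1) - t i) *
        (Real.exp (-(α * (s - t (i + 1)))) * Real.exp (ε * (s - t (i + 1))))) := by
      rw [hBdef]; ring
    _ = K * (D * Real.exp (ε * θ)) * ((t (i + 1) - t i) *
        Real.exp (-((α - ε) * (s - t (i + 1))))) := by
      rw [← Real.exp_add]; ring_nf
    _ ≤ _ := by gcongr

theorem IsDichotomyProj.norm_unstable_jump_le (hP : IsDichotomyProj A₀ t ζ P K α)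
    (h : IsPiecewiseConstArg t ζ γ θ) {g : ℝ → E} {ε D s : ℝ} (hε : 0 ≤ ε) (hεα : ε < α)
    (hD : 0 ≤ D) (hg : ∀ r, ‖g r‖ ≤ D * Real.exp (ε * |r - s|)) {i : ℤ} (hi : s < t i) :
    ‖transition A₀ t ζ s 0 (jump A₀ t ζ g i - P (jump A₀ t ζ g i))‖ ≤
      K * (D * Real.exp (ε * θ)) * (expRatio ((α - ε) * θ) / (α - ε) *
        (Real.exp (-((α - ε) * (t i - s))) - Real.exp (-((α - ε) * (t (i + 1) - s))))) := by
  have hlt := h.lt_succ i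
  have hgap := h.gap_le i
  have hK := hP.one_le
  have hα := hP.pos
  have hB : ∀ r ∈ Icc (t i) (t (i + 1)),
      ‖g r‖ ≤ D * Real.exp (ε * θ) * Real.exp (ε * (t i - s)) := fun r hr => by
    refine (hg r).trans ?_
    rw [mul_assoc, ← Real.exp_add, ← mul_add, abs_of_nonneg (by linarith [hr.1])]
    gcongr
    linarith [hr.2]
  have ha := h.norm_integral_left_le hB
  have hb := h.norm_integral_right_le hB
  set B := D * Real.exp (ε * θ) * Real.exp (ε * (t i - s)) with hBdef
  have h1 := hP.norm_unstable_le hi (∫ r in (t i)..(ζ i), g r)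
  have h2 := hP.norm_unstable_le (hi.trans hlt) (∫ r in (ζ i)..(t (i + 1)), g r)
  have h3 : Real.exp (-(α * (t (i + 1) - s))) ≤ Real.exp (-(α * (t i - s))) := by gcongr
  have h4 := gap_mul_exp_le (β := α - ε) (y := t i - s) (sub_pos.2 hεα) h.theta_pos
    (sub_nonneg.2 hlt.le) hgap
  rw [show t i - s + (t (i + 1) - t i) = t (i + 1) - s by ring] at h4
  rw [jump, map_add, add_sub_add_comm, map_add]
  calc _ ≤ _ := norm_add_le _ _
    _ ≤ K * Real.exp (-(α * (t i - s))) * (B * (ζ i - t i)) +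
        K * Real.exp (-(α * (t i - s))) * (B * (t (i + 1) - ζ i)) := by
      refine add_le_add (h1.trans ?_) (h2.trans ?_) <;> gcongr
    _ = K * (D * Real.exp (ε * θ)) * ((t (i + 1) - t i) *
        (Real.exp (-(α * (t i - s))) * Real.exp (ε * (t i - s)))) := by
      rw [hBdef]; ring
    _ = K * (D * Real.exp (ε * θ)) * ((t (i + 1) - t i) *
        Real.exp (-((α - ε) * (t i - s)))) := by
      rw [← Real.exp_add]; ring_nf
    _ ≤ _ := by gcongr

variable [CompleteSpace E]

theorem IsAdmissible.transition_grid_succ (H : IsAdmissible t ζ γ θ A₀ M₀ ℓ m) {g : ℝ → E}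
    (hg : PiecewiseContinuous t g) {w : ℝ → E}
    (hw : IsSolution t γ (quasiRHS A₀ (fun s _ _ => g s)) w) (i : ℤ) :
    transition A₀ t ζ 0 (t (i + 1)) (w (t (i + 1))) =
      transition A₀ t ζ 0 (t i) (w (t i)) + jump A₀ t ζ g i := by
  have h := H.transition_sub_integral hg hw (H.arg.right_mem i) (H.arg.left_mem i) 0
  rw [intervalIntegral.integral_symm (t i), sub_neg_eq_add, map_add, map_sub,
    sub_eq_iff_eq_add] at h
  rw [h, jump]
  abel

/-- A priori bound for the solutions of the inhomogeneous system whose stable part tends to `0`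
at `-∞` and whose unstable part tends to `0` at `+∞`. -/
theorem IsDichotomyProj.norm_le (hP : IsDichotomyProj A₀ t ζ P K α)
    (H : IsAdmissible t ζ γ θ A₀ M₀ ℓ m) {g : ℝ → E} (hgpc : PiecewiseContinuous t g)
    {w : ℝ → E} (hw : IsSolution t γ (quasiRHS A₀ (fun s _ _ => g s)) w)
    (hbot : Tendsto (fun j => P (transition A₀ t ζ 0 (t j) (w (t j)))) atBot (𝓝 0))
    (htop : Tendsto (fun j => transition A₀ t ζ 0 (t j) (w (t j)) -
      P (transition A₀ t ζ 0 (t j) (w (t j)))) atTop (𝓝 0))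
    {ε D s : ℝ} (hε : 0 ≤ ε) (hεα : ε < α) (hD : 0 ≤ D)
    (hg : ∀ r, ‖g r‖ ≤ D * Real.exp (ε * |r - s|)) :
    ‖w s‖ ≤ 2 * K * Real.exp (α * θ) / (α - ε) * D := by
  have hβ : 0 < α - ε := sub_pos.2 hεα
  have hθ := H.arg.theta_pos
  have hK := hP.one_le
  have hα := hP.pos
  have hsm := H.arg.strictMono.monotone
  have hb : 0 < (α - ε) * θ := mul_pos hβ hθ
  have hr := one_le_expRatio hb
  set β := α - ε with hβdef
  set V : ℤ → E := fun j => transition A₀ t ζ 0 (t j) (w (t j)) with hV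
  set D' := D * Real.exp (ε * θ) with hD'
  have hD'0 : 0 ≤ D' := by positivity
  set R := expRatio (β * θ) / β with hR
  have hR0 : 0 ≤ R := by positivity
  set j := idx t s with hj
  have hs : s ∈ Ico (t j) (t (j + 1)) := H.arg.idx_mem s
  have hs' := Ico_subset_Icc_self hs
  have hVs : ∀ i, V (i + 1) = V i + jump A₀ t ζ g i := H.transition_grid_succ hgpc hw
  -- Going back `n` grid steps, the jump bounds telescope and the remainder vanishes by `hbot`;
  -- `hun` is the mirror image in the future.
  have hst : ‖transition A₀ t ζ s 0 (P (V j))‖ ≤ K * D' * (R * Real.exp (-(β * (s - t j)))) := by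
    have key : ∀ n : ℕ, ‖transition A₀ t ζ s 0 (P (V j))‖ ≤
        ‖transition A₀ t ζ s 0 (P (V (j - n)))‖ + K * D' *
          (R * (Real.exp (-(β * (s - t j))) - Real.exp (-(β * (s - t (j - n)))))) := by
      intro n
      induction n with
      | zero => simp
      | succ n ih =>
        have e : j - ((n + 1 : ℕ) : ℤ) + 1 = j - n := by push_cast; ring
        have h1 := hP.norm_stable_jump_le H.arg hε hεα hD hg (i := j - ((n + 1 : ℕ) : ℤ))
          (by rw [e]; exact (hsm (by omega)).trans hs.1)
        have h2 := hVs (j - ((n + 1 : ℕ) : ℤ))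
        rw [e] at h1 h2
        rw [h2, map_add, map_add] at ih
        refine ih.trans ((add_le_add_left ((norm_add_le _ _).trans (add_le_add_right h1 _))
          _).trans (le_of_eq ?_))
        ring
    have hlim : Tendsto (fun n : ℕ => ‖transition A₀ t ζ s 0 (P (V (j - n)))‖ +
        K * D' * (R * Real.exp (-(β * (s - t j))))) atTop
        (𝓝 (0 + K * D' * (R * Real.exp (-(β * (s - t j)))))) := by
      have h1 : Tendsto (fun n : ℕ => j - (n : ℤ)) atTop atBot :=
        tendsto_atBot.2 fun b => by
          filter_upwards [eventually_ge_atTop (j - b).toNat] with n hn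
          omega
      have h2 := ((transition A₀ t ζ s 0).continuous.tendsto 0).comp (hbot.comp h1)
      rw [map_zero] at h2
      exact (tendsto_zero_iff_norm_tendsto_zero.1 h2).add_const _
    rw [zero_add] at hlim
    refine ge_of_tendsto' hlim fun n => (key n).trans ?_
    gcongr
    linarith [Real.exp_pos (-(β * (s - t (j - n))))]
  have hun : ‖transition A₀ t ζ s 0 (V (j + 1) - P (V (j + 1)))‖ ≤
      K * D' * (R * Real.exp (-(β * (t (j + 1) - s)))) := by
    have key : ∀ n : ℕ, ‖transition A₀ t ζ s 0 (V (j + 1) - P (V (j + 1)))‖ ≤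
        ‖transition A₀ t ζ s 0 (V (j + 1 + n) - P (V (j + 1 + n)))‖ + K * D' *
          (R * (Real.exp (-(β * (t (j + 1) - s))) - Real.exp (-(β * (t (j + 1 + n) - s))))) := by
      intro n
      induction n with
      | zero => simp
      | succ n ih =>
        have e : j + 1 + ((n + 1 : ℕ) : ℤ) = j + 1 + n + 1 := by push_cast; ring
        have h1 := hP.norm_unstable_jump_le H.arg hε hεα hD hg (i := j + 1 + n)
          (hs.2.trans_le (hsm (by omega)))
        have h3 : V (j + 1 + n) - P (V (j + 1 + n)) =
            (V (j + 1 + n + 1) - P (V (j + 1 + n + 1))) -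
              (jump A₀ t ζ g (j + 1 + n) - P (jump A₀ t ζ g (j + 1 + n))) := by
          rw [hVs (j + 1 + n), map_add]; abel
        rw [h3, map_sub _ (V (j + 1 + n + 1) - P (V (j + 1 + n + 1)))] at ih
        rw [e]
        refine ih.trans ((add_le_add_left ((norm_sub_le _ _).trans (add_le_add_right h1 _))
          _).trans (le_of_eq ?_))
        ring
    have hlim : Tendsto (fun n : ℕ => ‖transition A₀ t ζ s 0 (V (j + 1 + n) - P (V (j + 1 + n)))‖ +
        K * D' * (R * Real.exp (-(β * (t (j + 1) - s))))) atTop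
        (𝓝 (0 + K * D' * (R * Real.exp (-(β * (t (j + 1) - s)))))) := by
      have h1 : Tendsto (fun n : ℕ => j + 1 + (n : ℤ)) atTop atTop :=
        tendsto_atTop.2 fun b => by
          filter_upwards [eventually_ge_atTop (b - (j + 1)).toNat] with n hn
          omega
      have h2 := ((transition A₀ t ζ s 0).continuous.tendsto 0).comp (htop.comp h1)
      rw [map_zero] at h2
      exact (tendsto_zero_iff_norm_tendsto_zero.1 h2).add_const _
    rw [zero_add] at hlim
    refine ge_of_tendsto' hlim fun n => (key n).trans ?_
    gcongr
    linarith [Real.exp_pos (-(β * (t (j + 1 + n) - s)))]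
  have hB : ∀ r ∈ Icc (t j) (t (j + 1)), ‖g r‖ ≤ D' := fun r hr => by
    refine (hg r).trans ?_
    rw [hD']
    gcongr
    exact H.arg.abs_sub_le hr hs'
  have ha := H.arg.norm_integral_left_le hB
  have hbb := H.arg.norm_integral_right_le hB
  set a := ∫ r in (t j)..(ζ j), g r
  set b := ∫ r in (ζ j)..(t (j + 1)), g r
  have hI : ‖∫ r in (ζ j)..s, g r‖ ≤ D' * |s - ζ j| :=
    intervalIntegral.norm_integral_le_of_norm_le_const fun r hr =>
      hB r (uIcc_subset_Icc (H.arg.zeta_mem j) hs' (uIoc_subset_uIcc hr))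
  have hw1 : transition A₀ t ζ 0 s (w s - ∫ x in (ζ j)..s, g x) =
      V j + transition A₀ t ζ 0 (t j) a := by
    rw [H.transition_sub_integral hgpc hw hs' (H.arg.left_mem j) 0,
      intervalIntegral.integral_symm (t j), sub_neg_eq_add, map_add]
  have hw2 : V j + transition A₀ t ζ 0 (t j) a =
      V (j + 1) - transition A₀ t ζ 0 (t (j + 1)) b := by
    rw [hVs j, jump]; abel
  -- The stable part is read off at `t j` and the unstable part at `t (j + 1)`, so each meets only
  -- one half of the current jump. The five terms correspond to those in `green_bound`, the modulus
  -- there bounding the integral.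
  have hw3 : w s = (∫ x in (ζ j)..s, g x) +
      (transition A₀ t ζ s 0 (P (transition A₀ t ζ 0 (t j) a)) -
        transition A₀ t ζ s 0 (transition A₀ t ζ 0 (t (j + 1)) b -
          P (transition A₀ t ζ 0 (t (j + 1)) b)) +
      (transition A₀ t ζ s 0 (P (V j)) +
        transition A₀ t ζ s 0 (V (j + 1) - P (V (j + 1))))) := by
    have h1 : w s - ∫ x in (ζ j)..s, g x =
        transition A₀ t ζ s 0 (V j + transition A₀ t ζ 0 (t j) a) := by
      rw [← hw1, H.transition_transition, H.transition_self, one_apply_eq_self]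
    rw [sub_eq_iff_eq_add'.1 h1]
    congr 1
    have h2 : V j + transition A₀ t ζ 0 (t j) a =
        P (V j + transition A₀ t ζ 0 (t j) a) +
          ((V (j + 1) - transition A₀ t ζ 0 (t (j + 1)) b) -
            P (V (j + 1) - transition A₀ t ζ 0 (t (j + 1)) b)) := by
      rw [← hw2]; abel
    rw [h2]
    simp only [map_add, map_sub]
    abel
  have h1 := hP.norm_stable_le hs.1 a
  have h2 := hP.norm_unstable_le hs.2 b
  have hαβ : β ≤ α := by linarith
  have hp : 0 ≤ s - t j := sub_nonneg.2 hs.1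
  have hq : 0 ≤ t (j + 1) - s := sub_nonneg.2 hs.2.le
  have h1' : Real.exp (-(α * (s - t j))) ≤ Real.exp (-(β * (s - t j))) := by gcongr
  have h2' : Real.exp (-(α * (t (j + 1) - s))) ≤ Real.exp (-(β * (t (j + 1) - s))) := by gcongr
  have hz1 := sub_nonneg.2 (H.arg.le_zeta j)
  have hz2 := sub_nonneg.2 (H.arg.zeta_le j)
  have hgb := green_bound (p := β * (s - t j)) (q := β * (t (j + 1) - s)) (x := β * (ζ j - t j))
    hb (by positivity) (by positivity)
    (by nlinarith [H.arg.gap_le j]) (by positivity) (by nlinarith)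
  rw [← mul_sub, abs_mul, abs_of_pos hβ, show s - t j - (ζ j - t j) = s - ζ j by ring] at hgb
  set ep := Real.exp (-(β * (s - t j)))
  set eq := Real.exp (-(β * (t (j + 1) - s)))
  have hRβ : expRatio (β * θ) = β * R := by rw [hR]; field_simp
  rw [hRβ] at hgb
  have hfin : |s - ζ j| + ep * (ζ j - t j) + eq * (t (j + 1) - ζ j) + R * (ep + eq) ≤
      2 * Real.exp (β * θ) / β := by
    rw [le_div_iff₀ hβ]
    linarith
  have n1 := norm_add_le (∫ x in (ζ j)..s, g x)
    (transition A₀ t ζ s 0 (P (transition A₀ t ζ 0 (t j) a)) -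
        transition A₀ t ζ s 0 (transition A₀ t ζ 0 (t (j + 1)) b -
          P (transition A₀ t ζ 0 (t (j + 1)) b)) +
      (transition A₀ t ζ s 0 (P (V j)) +
        transition A₀ t ζ s 0 (V (j + 1) - P (V (j + 1)))))
  rw [← hw3] at n1
  have n2 := norm_add_le (transition A₀ t ζ s 0 (P (transition A₀ t ζ 0 (t j) a)) -
        transition A₀ t ζ s 0 (transition A₀ t ζ 0 (t (j + 1)) b -
          P (transition A₀ t ζ 0 (t (j + 1)) b)))
      (transition A₀ t ζ s 0 (P (V j)) + transition A₀ t ζ s 0 (V (j + 1) - P (V (j + 1))))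
  have n3 := norm_sub_le (transition A₀ t ζ s 0 (P (transition A₀ t ζ 0 (t j) a)))
        (transition A₀ t ζ s 0 (transition A₀ t ζ 0 (t (j + 1)) b -
          P (transition A₀ t ζ 0 (t (j + 1)) b)))
  have n4 := norm_add_le (transition A₀ t ζ s 0 (P (V j)))
    (transition A₀ t ζ s 0 (V (j + 1) - P (V (j + 1))))
  have m1 : K * Real.exp (-(α * (s - t j))) * ‖a‖ ≤ K * ep * (D' * (ζ j - t j)) := by gcongr
  have m2 : K * Real.exp (-(α * (t (j + 1) - s))) * ‖b‖ ≤ K * eq * (D' * (t (j + 1) - ζ j)) := by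
    gcongr
  have m3 : D' * |s - ζ j| ≤ K * (D' * |s - ζ j|) := le_mul_of_one_le_left (by positivity) hK
  calc ‖w s‖ ≤ K * D' * (|s - ζ j| + ep * (ζ j - t j) + eq * (t (j + 1) - ζ j) +
        R * (ep + eq)) := by linarith
    _ ≤ K * D' * (2 * Real.exp (β * θ) / β) := by gcongr
    _ = 2 * K * (Real.exp (ε * θ) * Real.exp (β * θ)) / β * D := by rw [hD']; ring
    _ = _ := by rw [← Real.exp_add, hβdef]; ring_nf

end

/-! ### Bounded solutions of the inhomogeneous system -/

section

variable {E : Type*} [NormedAddCommGroup E]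
variable {t ζ : ℤ → ℝ} {γ : ℝ → ℝ} {θ : ℝ}

theorem PiecewiseContinuous.sub {g g' : ℝ → E} (hg : PiecewiseContinuous t g)
    (hg' : PiecewiseContinuous t g') : PiecewiseContinuous t (fun s => g s - g' s) := fun i => by
  obtain ⟨hc, l, hl⟩ := hg i
  obtain ⟨hc', l', hl'⟩ := hg' i
  exact ⟨hc.sub hc', l - l', hl.sub hl'⟩

theorem summable_of_norm_le_telescoping [CompleteSpace E] {x : ℕ → E} {F : ℕ → ℝ} {C : ℝ}
    (hC : 0 ≤ C) (hF : ∀ n, 0 ≤ F n) (hx : ∀ n, ‖x n‖ ≤ C * (F n - F (n + 1))) : Summable x := by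
  refine Summable.of_norm (summable_of_sum_range_le (c := C * F 0) (fun _ => norm_nonneg _) ?_)
  intro n
  calc _ ≤ ∑ i ∈ Finset.range n, C * (F i - F (i + 1)) := Finset.sum_le_sum fun i _ => hx i
    _ = C * (F 0 - F n) := by rw [← Finset.mul_sum, Finset.sum_range_sub']
    _ ≤ _ := by
      gcongr
      linarith [hF n]

variable [NormedSpace ℝ E] {A₀ : ℝ → E →L[ℝ] E} {M₀ ℓ m : ℝ} {P : E →L[ℝ] E} {K α : ℝ}

theorem IsSolution.sub {g g' u u' : ℝ → E}
    (hu : IsSolution t γ (quasiRHS A₀ (fun s _ _ => g s)) u)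
    (hu' : IsSolution t γ (quasiRHS A₀ (fun s _ _ => g' s)) u') :
    IsSolution t γ (quasiRHS A₀ (fun s _ _ => g s - g' s)) (fun s => u s - u' s) := by
  have e : ∀ s a b, A₀ s a + g s - (A₀ s b + g' s) = A₀ s (a - b) + (g s - g' s) := by
    intro s a b
    rw [map_sub]; abel
  refine ⟨hu.1.sub hu'.1, fun i s hs => ((hu.2.1 i s hs).sub (hu'.2.1 i s hs)).congr_deriv (e _ _ _),
    fun i => ((hu.2.2.1 i).sub (hu'.2.2.1 i)).congr_deriv (e _ _ _),
    fun i => (hu.2.2.2 i).sub (hu'.2.2.2 i)⟩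

theorem IsSolution.add_lin {g u y : ℝ → E}
    (hu : IsSolution t γ (quasiRHS A₀ (fun s _ _ => g s)) u) (hy : IsSolution t γ (linRHS A₀) y) :
    IsSolution t γ (quasiRHS A₀ (fun s _ _ => g s)) (fun s => y s + u s) := by
  have e : ∀ s a b, A₀ s a + (A₀ s b + g s) = A₀ s (a + b) + g s := by
    intro s a b
    rw [map_add]; abel
  refine ⟨hy.1.add hu.1, fun i s hs => ((hy.2.1 i s hs).add (hu.2.1 i s hs)).congr_deriv (e _ _ _),
    fun i => ((hy.2.2.1 i).add (hu.2.2.1 i)).congr_deriv (e _ _ _),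
    fun i => (hy.2.2.2 i).add (hu.2.2.2 i)⟩

theorem tendsto_int_atTop_of_nat {X : Type*} {l : Filter X} {F : ℤ → X} (j : ℤ)
    (h : Tendsto (fun n : ℕ => F (j + n)) atTop l) : Tendsto F atTop l := by
  have h1 : Tendsto (fun k : ℤ => F (j + k)) atTop l := by
    rw [← Nat.map_cast_int_atTop]
    exact tendsto_map'_iff.2 h
  have h2 : Tendsto (fun i : ℤ => i - j) atTop atTop :=
    tendsto_atTop.2 fun b => by
      filter_upwards [eventually_ge_atTop (b + j)] with i hi
      omega
  simpa [Function.comp_def] using h1.comp h2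

theorem tendsto_int_atBot_of_nat {X : Type*} {l : Filter X} {F : ℤ → X} (j : ℤ)
    (h : Tendsto (fun n : ℕ => F (j - n)) atTop l) : Tendsto F atBot l := by
  have h1 : Tendsto (fun k : ℤ => F (-k)) atTop l :=
    tendsto_int_atTop_of_nat (-j) (by simpa only [neg_add, neg_neg, ← sub_eq_add_neg] using h)
  simpa [Function.comp_def] using h1.comp tendsto_neg_atBot_atTop

section

variable [CompleteSpace E]

/-- The dichotomy bound between times `t j` and `0` gives `K e^{α t_j} W`. With its unstable
counterpart it makes the a priori estimate available for every bounded solution. -/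
theorem IsDichotomyProj.tendsto_stable (hP : IsDichotomyProj A₀ t ζ P K α)
    (H : IsAdmissible t ζ γ θ A₀ M₀ ℓ m) {w : ℝ → E} {W : ℝ} (hW : ∀ s, ‖w s‖ ≤ W) :
    Tendsto (fun j => P (transition A₀ t ζ 0 (t j) (w (t j)))) atBot (𝓝 0) := by
  have hK := hP.one_le
  have h1 : Tendsto (fun j => K * Real.exp (α * t j) * W) atBot (𝓝 (K * 0 * W)) :=
    ((Real.tendsto_exp_atBot.comp (H.arg.tendsto_bot.const_mul_atBot hP.pos)).const_mul K).mul_const W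
  rw [mul_zero, zero_mul] at h1
  refine squeeze_zero_norm' ?_ h1
  filter_upwards [H.arg.tendsto_bot.eventually (eventually_le_atBot 0)] with j hj
  have := hP.norm_stable_le hj (w (t j))
  rw [H.transition_self, one_apply_eq_self, zero_sub, mul_neg, neg_neg] at this
  exact this.trans (by gcongr; exact hW _)

theorem IsDichotomyProj.tendsto_unstable (hP : IsDichotomyProj A₀ t ζ P K α)
    (H : IsAdmissible t ζ γ θ A₀ M₀ ℓ m) {w : ℝ → E} {W : ℝ} (hW : ∀ s, ‖w s‖ ≤ W) :
    Tendsto (fun j => transition A₀ t ζ 0 (t j) (w (t j)) -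
      P (transition A₀ t ζ 0 (t j) (w (t j)))) atTop (𝓝 0) := by
  have hK := hP.one_le
  have h1 : Tendsto (fun j => K * Real.exp (-(α * t j)) * W) atTop (𝓝 (K * 0 * W)) :=
    ((Real.tendsto_exp_neg_atTop_nhds_zero.comp
      (H.arg.tendsto_top.const_mul_atTop hP.pos)).const_mul K).mul_const W
  rw [mul_zero, zero_mul] at h1
  refine squeeze_zero_norm' ?_ h1
  filter_upwards [H.arg.tendsto_top.eventually (eventually_gt_atTop 0)] with j hj
  have := hP.norm_unstable_le hj (w (t j))
  rw [H.transition_self, one_apply_eq_self, sub_zero] at this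
  exact this.trans (by gcongr; exact hW _)

theorem IsDichotomyProj.norm_le_of_bounded (hP : IsDichotomyProj A₀ t ζ P K α)
    (H : IsAdmissible t ζ γ θ A₀ M₀ ℓ m) {g : ℝ → E} (hgpc : PiecewiseContinuous t g)
    {w : ℝ → E} (hw : IsSolution t γ (quasiRHS A₀ (fun s _ _ => g s)) w) {W : ℝ}
    (hW : ∀ s, ‖w s‖ ≤ W) {ε D s : ℝ} (hε : 0 ≤ ε) (hεα : ε < α) (hD : 0 ≤ D)
    (hg : ∀ r, ‖g r‖ ≤ D * Real.exp (ε * |r - s|)) :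
    ‖w s‖ ≤ 2 * K * Real.exp (α * θ) / (α - ε) * D :=
  hP.norm_le H hgpc hw (hP.tendsto_stable H hW) (hP.tendsto_unstable H hW) hε hεα hD hg

/-- A bounded inhomogeneity has a bounded response. -/
theorem IsDichotomyProj.exists_bounded_solution (hP : IsDichotomyProj A₀ t ζ P K α)
    (H : IsAdmissible t ζ γ θ A₀ M₀ ℓ m) {g : ℝ → E} (hgpc : PiecewiseContinuous t g)
    {D : ℝ} (hg : ∀ r, ‖g r‖ ≤ D) :
    ∃ w, IsSolution t γ (quasiRHS A₀ (fun s _ _ => g s)) w ∧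
      ∀ s, ‖w s‖ ≤ 2 * K * Real.exp (α * θ) / α * D := by
  have hD : 0 ≤ D := (norm_nonneg _).trans (hg 0)
  have hα := hP.pos
  have hK := hP.one_le
  have hr := one_le_expRatio (mul_pos hα H.arg.theta_pos)
  have hsm := H.arg.strictMono.monotone
  have hg0 : ∀ s r, ‖g r‖ ≤ D * Real.exp (0 * |r - s|) := fun s r => by simpa using hg r
  set J := jump A₀ t ζ g with hJ
  set j := idx t 0 with hj
  have h0 := H.arg.idx_mem 0
  have hS : Summable fun n : ℕ => P (J (j - (n : ℤ) - 1)) := by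
    refine summable_of_norm_le_telescoping (C := K * D * (expRatio (α * θ) / α))
      (F := fun n : ℕ => Real.exp (α * t (j - n))) (by positivity) (fun _ => (Real.exp_pos _).le)
      fun n => ?_
    have e : j - (n : ℤ) - 1 + 1 = j - n := by ring
    have := hP.norm_stable_jump_le H.arg le_rfl hα hD (hg0 0) (i := j - (n : ℤ) - 1)
      (by rw [e]; exact (hsm (by omega)).trans h0.1)
    rw [H.transition_self, one_apply_eq_self, e] at this
    simp only [zero_mul, Real.exp_zero, mul_one, sub_zero, zero_sub, mul_neg, neg_neg] at this
    rw [show j - ((n + 1 : ℕ) : ℤ) = j - n - 1 by push_cast; ring]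
    linarith
  have hU : Summable fun n : ℕ => J (j + 1 + n) - P (J (j + 1 + n)) := by
    refine summable_of_norm_le_telescoping (C := K * D * (expRatio (α * θ) / α))
      (F := fun n : ℕ => Real.exp (-(α * t (j + 1 + n)))) (by positivity)
      (fun _ => (Real.exp_pos _).le) fun n => ?_
    have := hP.norm_unstable_jump_le H.arg le_rfl hα hD (hg0 0) (i := j + 1 + (n : ℤ))
      (h0.2.trans_le (hsm (by omega)))
    rw [H.transition_self, one_apply_eq_self] at this
    simp only [zero_mul, Real.exp_zero, mul_one, sub_zero] at this
    rw [show j + 1 + ((n + 1 : ℕ) : ℤ) = j + 1 + n + 1 by push_cast; ring]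
    linarith
  set S := ∑' n : ℕ, P (J (j - (n : ℤ) - 1)) with hSdef
  set U := ∑' n : ℕ, (J (j + 1 + n) - P (J (j + 1 + n))) with hUdef
  have hPS : P S = S := by
    rw [hSdef, P.map_tsum hS]
    simp only [hP.apply_apply]
  have hPU : P U = 0 := by
    rw [hUdef, P.map_tsum hU]
    simp only [map_sub, hP.apply_apply, sub_self, tsum_zero]
  -- The stable part at `t j` has to be the sum of the past jumps, and the unstable part at `t (j +
  -- 1)` minus the sum of the future ones. The last term carries the latter back to `t j`; the
  -- future series starts at `j + 1` because `t j ≤ 0 < t (j + 1)`.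
  set v := S - U - (J j - P (J j)) with hv
  have hPv : P v = S := by
    simp only [hv, map_sub, hPS, hPU, hP.apply_apply, sub_self, sub_zero]
  obtain ⟨w, hw, hwj⟩ := exists_solution H.arg H.ℓ_pos H.m_pos H.small (H.isLipRHS_inhom hgpc) (t j)
    (transition A₀ t ζ (t j) 0 v)
  refine ⟨w, hw, ?_⟩
  set V : ℤ → E := fun i => transition A₀ t ζ 0 (t i) (w (t i)) with hV
  have hVj : V j = v := by
    simp only [hV, hwj, H.transition_transition, H.transition_self, one_apply_eq_self]
  have hVs : ∀ i, V (i + 1) = V i + J i := H.transition_grid_succ hgpc hw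
  have hbot : Tendsto (fun i => P (V i)) atBot (𝓝 0) := by
    refine tendsto_int_atBot_of_nat j ?_
    have h1 : ∀ n : ℕ, P (V (j - n)) = S - ∑ k ∈ Finset.range n, P (J (j - (k : ℤ) - 1)) := by
      intro n
      induction n with
      | zero => simp [hVj, hPv]
      | succ n ih =>
        have h2 := hVs (j - (n : ℤ) - 1)
        rw [show j - (n : ℤ) - 1 + 1 = j - n by ring] at h2
        rw [show j - ((n + 1 : ℕ) : ℤ) = j - n - 1 by push_cast; ring, Finset.sum_range_succ,
          ← sub_sub, ← ih, h2, map_add]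
        abel
    simp only [h1]
    have h2 := hS.hasSum.tendsto_sum_nat.const_sub S
    rwa [← hSdef, sub_self] at h2
  have htop : Tendsto (fun i => V i - P (V i)) atTop (𝓝 0) := by
    refine tendsto_int_atTop_of_nat (j + 1) ?_
    have h1 : ∀ n : ℕ, V (j + 1 + n) - P (V (j + 1 + n)) =
        ∑ k ∈ Finset.range n, (J (j + 1 + k) - P (J (j + 1 + k))) - U := by
      intro n
      induction n with
      | zero =>
        simp only [Nat.cast_zero, add_zero, Finset.range_zero, Finset.sum_empty, hVs, hVj, map_add,
          hPv]
        rw [hv]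
        abel
      | succ n ih =>
        rw [show j + 1 + ((n + 1 : ℕ) : ℤ) = j + 1 + n + 1 by push_cast; ring,
          Finset.sum_range_succ, hVs, map_add, add_sub_add_comm, ih]
        abel
    simp only [h1]
    have h2 := hU.hasSum.tendsto_sum_nat.sub_const U
    rwa [← hUdef, sub_self] at h2
  intro s
  simpa using hP.norm_le H hgpc hw hbot htop le_rfl hα hD (hg0 s)

/-- A bounded solution is small at `τ` if the inhomogeneity is small near `τ`, up to a
contribution controlled by the solution itself. -/
theorem IsDichotomyProj.norm_le_of_weighted (hP : IsDichotomyProj A₀ t ζ P K α)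
    (H : IsAdmissible t ζ γ θ A₀ M₀ ℓ m) {g : ℝ → E} (hgpc : PiecewiseContinuous t g)
    {w : ℝ → E} (hw : IsSolution t γ (quasiRHS A₀ (fun s _ _ => g s)) w) {W : ℝ}
    (hW : ∀ s, ‖w s‖ ≤ W) {ℓ₁ ℓ₂ ε D τ κ : ℝ} (hℓ₁ : 0 ≤ ℓ₁) (hℓ₂ : 0 ≤ ℓ₂) (hε : 0 ≤ ε)
    (hεα : ε < α) (hD : 0 ≤ D) (hκ : κ = 2 * K * Real.exp (α * θ) / (α - ε))
    (hκ1 : κ * (ℓ₁ + ℓ₂ * Real.exp (ε * θ)) < 1)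
    (hg : ∀ r, ‖g r‖ ≤ D * Real.exp (ε * |r - τ|) + (ℓ₁ * ‖w r‖ + ℓ₂ * ‖w (γ r)‖)) :
    ‖w τ‖ ≤ κ / (1 - κ * (ℓ₁ + ℓ₂ * Real.exp (ε * θ))) * D := by
  have hK := hP.one_le
  have hκ0 : 0 ≤ κ := by
    rw [hκ]
    have := sub_pos.2 hεα
    positivity
  -- This supremum is finite because `w` is bounded. The estimate recentred at each `s` gives `N ≤ κ
  -- (D + L N)`, and `κ L < 1` lets the `N` on the right be absorbed.
  set N := ⨆ s, Real.exp (-(ε * |s - τ|)) * ‖w s‖ with hN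
  have hbdd : BddAbove (range fun s => Real.exp (-(ε * |s - τ|)) * ‖w s‖) := by
    refine ⟨1 * W, ?_⟩
    rintro _ ⟨s, rfl⟩
    have h1 : Real.exp (-(ε * |s - τ|)) ≤ 1 :=
      Real.exp_le_one_iff.2 (neg_nonpos.2 (by positivity))
    exact mul_le_mul h1 (hW s) (norm_nonneg _) zero_le_one
  have hwN : ∀ s, ‖w s‖ ≤ N * Real.exp (ε * |s - τ|) := fun s => by
    have h1 := mul_le_mul_of_nonneg_right (le_ciSup hbdd s) (Real.exp_pos (ε * |s - τ|)).le
    rw [mul_right_comm, ← Real.exp_add, neg_add_cancel, Real.exp_zero, one_mul] at h1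
    exact h1
  have hN0 : 0 ≤ N := by
    have := (norm_nonneg _).trans (hwN τ)
    simpa using this
  set L := ℓ₁ + ℓ₂ * Real.exp (ε * θ) with hL
  have hL0 : 0 ≤ L := by positivity
  have hgN : ∀ r, ‖g r‖ ≤ (D + L * N) * Real.exp (ε * |r - τ|) := fun r => by
    have h1 := hwN r
    have h2 : ‖w (γ r)‖ ≤ N * (Real.exp (ε * θ) * Real.exp (ε * |r - τ|)) := by
      refine (hwN _).trans ?_
      rw [← Real.exp_add, ← mul_add]
      gcongr
      calc |γ r - τ| = |(γ r - r) + (r - τ)| := by ring_nf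
        _ ≤ _ := abs_add_le _ _
        _ ≤ _ := by gcongr; exact H.arg.abs_arg_sub_le r
    calc _ ≤ _ := hg r
      _ ≤ D * Real.exp (ε * |r - τ|) + (ℓ₁ * (N * Real.exp (ε * |r - τ|)) +
          ℓ₂ * (N * (Real.exp (ε * θ) * Real.exp (ε * |r - τ|)))) := by gcongr
      _ = _ := by rw [hL]; ring
  have hw' : ∀ s, ‖w s‖ ≤ κ * ((D + L * N) * Real.exp (ε * |s - τ|)) := fun s => by
    rw [hκ]
    refine hP.norm_le_of_bounded H hgpc hw hW hε hεα (by positivity) fun r => (hgN r).trans ?_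
    rw [mul_assoc, ← Real.exp_add, ← mul_add]
    gcongr
    calc |r - τ| = |(s - τ) + (r - s)| := by ring_nf
      _ ≤ _ := abs_add_le _ _
  have hNle : N ≤ κ * (D + L * N) := by
    refine ciSup_le fun s => ?_
    calc _ ≤ Real.exp (-(ε * |s - τ|)) * (κ * ((D + L * N) * Real.exp (ε * |s - τ|))) := by
          gcongr
          exact hw' s
      _ = κ * (D + L * N) * (Real.exp (-(ε * |s - τ|)) * Real.exp (ε * |s - τ|)) := by ring
      _ = _ := by rw [← Real.exp_add]; simp
  have h1 : ‖w τ‖ ≤ N := by simpa using hwN τ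
  refine h1.trans ?_
  rw [div_mul_eq_mul_div, le_div_iff₀ (by linarith)]
  nlinarith

end

end

section

/-! ### Hölder bounds and interpolation -/

section Holder

variable {E : Type*} [NormedAddCommGroup E]

theorem HolderAll.unifContAll {H : ℝ → E → E} (hH : HolderAll H) : UnifContAll H := by
  obtain ⟨C, κ, hC, hκ, -, h⟩ := hH
  intro ε hε
  have hlim : Tendsto (fun x : ℝ => C * x ^ κ) (𝓝 0) (𝓝 (C * 0 ^ κ)) :=
    ((Real.continuousAt_rpow_const 0 κ (Or.inr hκ.le)).tendsto).const_mul C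
  rw [Real.zero_rpow hκ.ne', mul_zero] at hlim
  obtain ⟨δ, hδ, hball⟩ := Metric.eventually_nhds_iff.1 (hlim.eventually (gt_mem_nhds hε))
  refine ⟨min δ 1, lt_min hδ one_pos, fun s u v huv => ?_⟩
  refine (h s u v (huv.trans_le (min_le_right _ _))).trans_lt (hball ?_)
  rw [Real.dist_eq, sub_zero, abs_of_nonneg (norm_nonneg _)]
  exact huv.trans_le (min_le_left _ _)

theorem UnifContAll.continuous {H : ℝ → E → E} (hH : UnifContAll H) (s : ℝ) :
    Continuous (H s) := by
  refine Metric.continuous_iff.2 fun v ε hε => ?_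
  obtain ⟨δ, hδ, h⟩ := hH ε hε
  refine ⟨δ, hδ, fun u hu => ?_⟩
  rw [dist_eq_norm] at hu ⊢
  exact h s u v hu

theorem holderAll_of_norm_sub_le {H : ℝ → E → E} {C q : ℝ} (hC : 0 ≤ C) (hq : 0 < q) (hq1 : q < 1)
    (h : ∀ s u v, ‖(u - v) - (H s u - H s v)‖ ≤ C * ‖u - v‖ ^ q) : HolderAll H := by
  -- One unit pays for the identity part; the other makes the constant strictly larger than `1`.
  refine ⟨C + 2, q, by linarith, hq, hq1, fun s u v huv => ?_⟩
  have h1 : ‖u - v‖ ≤ ‖u - v‖ ^ q := by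
    have := Real.rpow_le_rpow_of_exponent_ge' (norm_nonneg (u - v)) huv.le hq.le hq1.le
    rwa [Real.rpow_one] at this
  have h2 : H s u - H s v = (u - v) - ((u - v) - (H s u - H s v)) := by abel
  have h3 : (0 : ℝ) ≤ ‖u - v‖ ^ q := Real.rpow_nonneg (norm_nonneg _) _
  calc ‖H s u - H s v‖ ≤ ‖u - v‖ + ‖(u - v) - (H s u - H s v)‖ := by
        rw [h2]; exact (norm_sub_le _ _).trans (by rw [← h2])
    _ ≤ ‖u - v‖ ^ q + C * ‖u - v‖ ^ q := add_le_add h1 (h s u v)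
    _ ≤ _ := by linarith

theorem min_le_mul_rpow {M c x q : ℝ} (hM : 0 ≤ M) (hc : 0 ≤ c) (hx : 0 ≤ x) (hq : 0 < q)
    (hq1 : q < 1) : min M (c * x) ≤ (M + c) * x ^ q := by
  rcases le_total x 1 with h | h
  · have h1 : x ≤ x ^ q := by
      have := Real.rpow_le_rpow_of_exponent_ge' hx h hq.le hq1.le
      rwa [Real.rpow_one] at this
    refine (min_le_right _ _).trans ?_
    nlinarith [mul_le_mul_of_nonneg_left h1 hc, mul_nonneg hM (hx.trans h1)]
  · have h1 : 1 ≤ x ^ q := Real.one_le_rpow h hq.le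
    refine (min_le_left _ _).trans ?_
    nlinarith

end Holder

/-! ### Pairing solutions and the equivalence -/

variable {E : Type*} [NormedAddCommGroup E] [NormedSpace ℝ E]
variable {t ζ : ℤ → ℝ} {γ : ℝ → ℝ} {θ : ℝ} {A₀ : ℝ → E →L[ℝ] E} {M₀ ℓ m : ℝ}
variable {P : E →L[ℝ] E} {K α : ℝ}

/-- The data of a bounded Lipschitz perturbation of a system with an exponential dichotomy, for
which the perturbation is small compared with the dichotomy. -/
structure IsSmallPerturbation (t ζ : ℤ → ℝ) (γ : ℝ → ℝ) (θ : ℝ) (A₀ : ℝ → E →L[ℝ] E)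
    (M₀ ℓ₁ ℓ₂ μ : ℝ) (f : ℝ → E → E → E) (P : E →L[ℝ] E) (K α : ℝ) : Prop where
  adm : IsAdmissible t ζ γ θ A₀ M₀ ℓ₁ (M₀ + ℓ₂)
  dich : IsDichotomyProj A₀ t ζ P K α
  ℓ₂_pos : 0 < ℓ₂
  μ_nonneg : 0 ≤ μ
  lip : IsLipRHS t ℓ₁ ℓ₂ f
  bound : ∀ s x y, ‖f s x y‖ ≤ μ
  small : 2 * (ℓ₁ + ℓ₂) * K * Real.exp (α * θ) < α

variable {ℓ₁ ℓ₂ μ : ℝ} {f : ℝ → E → E → E}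

theorem IsSmallPerturbation.isLipRHS
    (S : IsSmallPerturbation t ζ γ θ A₀ M₀ ℓ₁ ℓ₂ μ f P K α) :
    IsLipRHS t ℓ₁ (M₀ + ℓ₂) (quasiRHS A₀ f) :=
  S.adm.isLipRHS_quasiRHS le_rfl S.lip.pc S.lip.lip

variable [CompleteSpace E]

/-- Along a given `x` the nonlinearity is just a bounded forcing; subtracting its bounded response
removes it. -/
theorem IsSmallPerturbation.exists_lin_near
    (S : IsSmallPerturbation t ζ γ θ A₀ M₀ ℓ₁ ℓ₂ μ f P K α) {x : ℝ → E}
    (hx : IsSolution t γ (quasiRHS A₀ f) x) :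
    ∃ y, IsSolution t γ (linRHS A₀) y ∧
      ∀ s, ‖x s - y s‖ ≤ 2 * K * Real.exp (α * θ) / α * μ := by
  obtain ⟨w, hw, hwb⟩ := S.dich.exists_bounded_solution S.adm
    (S.lip.piecewiseContinuous S.adm.arg hx.1) (fun r => S.bound _ _ _)
  refine ⟨fun s => x s - w s, ?_, fun s => by simpa using hwb s⟩
  have h := IsSolution.sub (g := fun s => f s (x s) (x (γ s))) hx hw
  simpa only [sub_self, ← linRHS_eq_quasiRHS] using h

/-- The correction `z` must be the bounded response to `f` along `y + z`. By the estimate with `ε =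
0` this response depends on `z` with Lipschitz constant `κ (ℓ₁ + ℓ₂) < 1`. -/
theorem IsSmallPerturbation.exists_quasi_near
    (S : IsSmallPerturbation t ζ γ θ A₀ M₀ ℓ₁ ℓ₂ μ f P K α) {y : ℝ → E}
    (hy : IsSolution t γ (linRHS A₀) y) :
    ∃ x, IsSolution t γ (quasiRHS A₀ f) x ∧
      ∀ s, ‖x s - y s‖ ≤ 2 * K * Real.exp (α * θ) / α * μ := by
  have hα := S.dich.pos
  have hK := S.dich.one_le
  have hℓ₁ := S.adm.ℓ_pos
  have hℓ₂ := S.ℓ₂_pos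
  set κ := 2 * K * Real.exp (α * θ) / α with hκ
  have hκ0 : 0 ≤ κ := by positivity
  have hpc : ∀ z : BoundedContinuousFunction ℝ E, PiecewiseContinuous t
      (fun s => f s (y s + z s) (y (γ s) + z (γ s))) := fun z =>
    S.lip.piecewiseContinuous (u := fun s => y s + z s) S.adm.arg (hy.1.add z.continuous)
  choose T hT hTb using fun z : BoundedContinuousFunction ℝ E =>
    S.dich.exists_bounded_solution S.adm (hpc z) (fun r => S.bound _ _ _)
  let T' : BoundedContinuousFunction ℝ E → BoundedContinuousFunction ℝ E := fun z =>
    BoundedContinuousFunction.ofNormedAddCommGroup (T z) (hT z).1 (κ * μ) (hTb z)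
  have hcontr : ContractingWith ⟨κ * (ℓ₁ + ℓ₂), mul_nonneg hκ0 (by linarith)⟩ T' := by
    refine ⟨?_, LipschitzWith.of_dist_le_mul fun z z' => ?_⟩
    · have : κ * (ℓ₁ + ℓ₂) < 1 := by
        rw [hκ, div_mul_eq_mul_div, div_lt_one hα]
        linarith [S.small]
      exact this
    · refine (BoundedContinuousFunction.dist_le
        (mul_nonneg (mul_nonneg hκ0 (by linarith)) dist_nonneg)).2 fun s => ?_
      have hd : ∀ r, ‖z r - z' r‖ ≤ dist z z' := fun r => by
        rw [← dist_eq_norm]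
        exact BoundedContinuousFunction.dist_coe_le_dist r
      have := S.dich.norm_le_of_bounded S.adm ((hpc z).sub (hpc z')) ((hT z).sub (hT z'))
        (W := κ * μ + κ * μ) (fun r => (norm_sub_le _ _).trans (add_le_add (hTb z r) (hTb z' r)))
        (ε := 0) (D := (ℓ₁ + ℓ₂) * dist z z') (s := s) le_rfl hα (by positivity) fun r => by
          rw [zero_mul, Real.exp_zero, mul_one]
          refine (S.lip.lip _ _ _ _ _).trans ?_
          rw [add_sub_add_left_eq_sub, add_sub_add_left_eq_sub, add_mul]
          gcongr
          · exact hd _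
          · exact hd _
      rw [sub_zero, ← hκ] at this
      rw [dist_eq_norm]
      calc _ ≤ κ * ((ℓ₁ + ℓ₂) * dist z z') := this
        _ = _ := (mul_assoc _ _ _).symm
  obtain ⟨z, hz⟩ : ∃ z, T' z = z := ⟨_, hcontr.fixedPoint_isFixedPt⟩
  have hz' : T z = z := congrArg DFunLike.coe hz
  have hsol := (hT z).add_lin hy
  rw [hz'] at hsol
  exact ⟨fun s => y s + z s, hsol, fun s => by simpa [hz'] using hTb z s⟩

/-- Hölder dependence of the distance between a solution of one system and the nearby solution of
the other one. -/
theorem IsSmallPerturbation.exists_holder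
    (S : IsSmallPerturbation t ζ γ θ A₀ M₀ ℓ₁ ℓ₂ μ f P K α) :
    ∃ C q : ℝ, 0 ≤ C ∧ 0 < q ∧ q < 1 ∧ ∀ {x x' y y' : ℝ → E} {B : ℝ},
      IsSolution t γ (quasiRHS A₀ f) x → IsSolution t γ (quasiRHS A₀ f) x' →
      IsSolution t γ (linRHS A₀) y → IsSolution t γ (linRHS A₀) y' →
      (∀ s, ‖x s - y s‖ ≤ B) → (∀ s, ‖x' s - y' s‖ ≤ B) → ∀ τ,
      ‖(x τ - x' τ) - (y τ - y' τ)‖ ≤ C * ‖x τ - x' τ‖ ^ q ∧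
      ‖(x τ - x' τ) - (y τ - y' τ)‖ ≤ C * ‖y τ - y' τ‖ ^ q := by
  have hα := S.dich.pos
  have hK := S.dich.one_le
  have hℓ₁ := S.adm.ℓ_pos
  have hℓ₂ := S.ℓ₂_pos
  have hμ := S.μ_nonneg
  obtain ⟨p, hp0, hp⟩ := exists_growth (E := E) S.adm.ℓ_pos S.adm.m_pos S.adm.small
  -- At `ε = 0` the last inequality is the smallness hypothesis, so it persists for small `ε > 0`;
  -- `ε < p` keeps the exponent `ε / p` below `1`.
  obtain ⟨ε, hε0, hεα, hεp, hε1⟩ : ∃ ε : ℝ, 0 < ε ∧ ε < α ∧ ε < p ∧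
      2 * K * Real.exp (α * θ) / (α - ε) * (ℓ₁ + ℓ₂ * Real.exp (ε * θ)) < 1 := by
    have hcont : ContinuousAt (fun ε : ℝ => 2 * K * Real.exp (α * θ) / (α - ε) *
        (ℓ₁ + ℓ₂ * Real.exp (ε * θ))) 0 := by
      have : ContinuousAt (fun ε : ℝ => 2 * K * Real.exp (α * θ) / (α - ε)) 0 :=
        continuousAt_const.div (by fun_prop) (by simpa using hα.ne')
      fun_prop
    have h1 : ∀ᶠ ε in 𝓝[>] (0 : ℝ), 2 * K * Real.exp (α * θ) / (α - ε) *
        (ℓ₁ + ℓ₂ * Real.exp (ε * θ)) < 1 := by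
      refine nhdsWithin_le_nhds (hcont.eventually_lt continuousAt_const ?_)
      simp only [sub_zero, zero_mul, Real.exp_zero, mul_one]
      rw [div_mul_eq_mul_div, div_lt_one hα]
      linarith [S.small]
    obtain ⟨ε, ⟨⟨h1, h2⟩, h3⟩, h4⟩ := (((h1.and (nhdsWithin_le_nhds (gt_mem_nhds hα))).and
      (nhdsWithin_le_nhds (gt_mem_nhds hp0))).and self_mem_nhdsWithin).exists
    exact ⟨ε, h4, h2, h3, h1⟩
  set κ := 2 * K * Real.exp (α * θ) / (α - ε) with hκ
  set c := (ℓ₁ + ℓ₂) * Real.exp (p * θ) with hc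
  have hc0 : 0 ≤ c := by positivity
  have hκ0 : 0 ≤ κ := by
    have := sub_pos.2 hεα
    positivity
  have hq : 0 < ε / p := by positivity
  have hq1 : ε / p < 1 := (div_lt_one hp0).2 hεp
  have hκ' : 0 < 1 - κ * (ℓ₁ + ℓ₂ * Real.exp (ε * θ)) := sub_pos.2 hε1
  refine ⟨κ / (1 - κ * (ℓ₁ + ℓ₂ * Real.exp (ε * θ))) * (2 * μ + c), ε / p, by positivity, hq, hq1,
    ?_⟩
  intro x x' y y' B hx hx' hy hy' hB hB' τ
  set w : ℝ → E := fun s => (x s - x' s) - (y s - y' s) with hw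
  set g : ℝ → E := fun s => f s (x s) (x (γ s)) - f s (x' s) (x' (γ s)) with hg
  have hgpc : PiecewiseContinuous t g :=
    (S.lip.piecewiseContinuous S.adm.arg hx.1).sub (S.lip.piecewiseContinuous S.adm.arg hx'.1)
  have hwsol : IsSolution t γ (quasiRHS A₀ (fun s _ _ => g s)) w := by
    have h1 : IsSolution t γ (quasiRHS A₀ (fun s _ _ => g s)) (fun s => x s - x' s) :=
      IsSolution.sub (g := fun s => f s (x s) (x (γ s)))
        (g' := fun s => f s (x' s) (x' (γ s))) hx hx'
    rw [linRHS_eq_quasiRHS] at hy hy'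
    simpa only [sub_zero] using h1.sub (hy.sub hy')
  have hwb : ∀ s, ‖w s‖ ≤ B + B := fun s => by
    have e : w s = (x s - y s) - (x' s - y' s) := by simp only [hw]; abel
    rw [e]
    exact (norm_sub_le _ _).trans (add_le_add (hB s) (hB' s))
  -- `d` will be `x - x'` or `y - y'`; only its growth rate and `‖x - x'‖ ≤ ‖d‖ + ‖w‖` matter, so
  -- both Hölder bounds come at once.
  have main : ∀ d : ℝ → E, (∀ s, ‖d s‖ ≤ Real.exp (p * |s - τ|) * ‖d τ‖) →
      (∀ s, ‖x s - x' s‖ ≤ ‖d s‖ + ‖w s‖) →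
      ‖w τ‖ ≤ κ / (1 - κ * (ℓ₁ + ℓ₂ * Real.exp (ε * θ))) * (2 * μ + c) * ‖d τ‖ ^ (ε / p) := by
    intro d hd hxd
    have hδ := norm_nonneg (d τ)
    rw [mul_assoc]
    refine S.dich.norm_le_of_weighted S.adm hgpc hwsol hwb hℓ₁.le hℓ₂.le hε0.le hεα
      (by positivity) hκ hε1 fun r => ?_
    have h1 : ‖g r‖ ≤ 2 * μ := by
      have := (norm_sub_le (f r (x r) (x (γ r))) (f r (x' r) (x' (γ r)))).trans
        (add_le_add (S.bound _ _ _) (S.bound _ _ _))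
      linarith
    have h2 : ‖g r‖ ≤ c * (Real.exp (p * |r - τ|) * ‖d τ‖) + (ℓ₁ * ‖w r‖ + ℓ₂ * ‖w (γ r)‖) := by
      have h3 : ‖d r‖ ≤ Real.exp (p * θ) * (Real.exp (p * |r - τ|) * ‖d τ‖) := by
        refine (hd r).trans (le_mul_of_one_le_left (by positivity) (Real.one_le_exp ?_))
        have := S.adm.arg.theta_pos
        positivity
      have h4 : ‖d (γ r)‖ ≤ Real.exp (p * θ) * (Real.exp (p * |r - τ|) * ‖d τ‖) := by
        refine (hd _).trans ?_
        rw [← mul_assoc, ← Real.exp_add, ← mul_add]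
        gcongr
        calc |γ r - τ| = |(γ r - r) + (r - τ)| := by ring_nf
          _ ≤ _ := abs_add_le _ _
          _ ≤ _ := by gcongr; exact S.adm.arg.abs_arg_sub_le r
      have h5 := hxd r
      have h6 := hxd (γ r)
      calc ‖g r‖ ≤ ℓ₁ * ‖x r - x' r‖ + ℓ₂ * ‖x (γ r) - x' (γ r)‖ := S.lip.lip _ _ _ _ _
        _ ≤ ℓ₁ * (‖d r‖ + ‖w r‖) + ℓ₂ * (‖d (γ r)‖ + ‖w (γ r)‖) := by gcongr
        _ ≤ ℓ₁ * (Real.exp (p * θ) * (Real.exp (p * |r - τ|) * ‖d τ‖) + ‖w r‖) +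
            ℓ₂ * (Real.exp (p * θ) * (Real.exp (p * |r - τ|) * ‖d τ‖) + ‖w (γ r)‖) := by gcongr
        _ = _ := by rw [hc]; ring
    have hw0 : 0 ≤ ℓ₁ * ‖w r‖ + ℓ₂ * ‖w (γ r)‖ := by positivity
    have h7 := min_le_mul_rpow (M := 2 * μ) (c := c) (x := Real.exp (p * |r - τ|) * ‖d τ‖)
      (by positivity) hc0 (by positivity) hq hq1
    -- The exponent `ε / p` slows growth at rate `p` to the admissible rate `ε < α`.
    have h8 : (Real.exp (p * |r - τ|) * ‖d τ‖) ^ (ε / p) =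
        Real.exp (ε * |r - τ|) * ‖d τ‖ ^ (ε / p) := by
      rw [Real.mul_rpow (Real.exp_pos _).le hδ, ← Real.exp_mul]
      congr 2
      field_simp
    rw [h8] at h7
    have h9 : ‖g r‖ ≤ min (2 * μ) (c * (Real.exp (p * |r - τ|) * ‖d τ‖)) +
        (ℓ₁ * ‖w r‖ + ℓ₂ * ‖w (γ r)‖) := by
      rw [← sub_le_iff_le_add]
      exact le_min (by linarith) (by linarith)
    refine h9.trans ?_
    linarith
  refine ⟨main (fun s => x s - x' s) (fun s => hp S.adm.arg S.isLipRHS hx hx' s τ) fun s => ?_,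
    main (fun s => y s - y' s) (fun s => hp S.adm.arg S.adm.isLipRHS_linRHS hy hy' s τ) fun s => ?_⟩
  · exact le_add_of_nonneg_right (norm_nonneg _)
  · have e : x s - x' s = (y s - y' s) + w s := by simp only [hw]; abel
    rw [e]
    exact norm_add_le _ _

/-- Hölder linearization of a small bounded perturbation of a system with an exponential
dichotomy. -/
theorem IsSmallPerturbation.holderStronglyTopEquiv
    (S : IsSmallPerturbation t ζ γ θ A₀ M₀ ℓ₁ ℓ₂ μ f P K α) :
    HolderStronglyTopEquiv t γ (linRHS A₀) (quasiRHS A₀ f) := by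
  obtain ⟨C, q, hC, hq, hq1, hhol⟩ := S.exists_holder
  choose X hX hXs using exists_solution S.adm.arg S.adm.ℓ_pos S.adm.m_pos S.adm.small S.isLipRHS
  choose Y hY hYs using exists_solution S.adm.arg S.adm.ℓ_pos S.adm.m_pos S.adm.small
    S.adm.isLipRHS_linRHS
  choose Y' hY' hXY' using fun s u => S.exists_lin_near (hX s u)
  choose X' hX' hX'Y using fun s u => S.exists_quasi_near (hY s u)
  set B := 2 * K * Real.exp (α * θ) / α * μ
  -- Follow the solution of the nonlinear system through `u` at time `s` and take the value of its
  -- partner at `s`; `L` does the reverse.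
  let H : ℝ → E → E := fun s u => Y' s u s
  let L : ℝ → E → E := fun s u => X' s u s
  -- At zero distance the Hölder estimate forces equality, so `H` follows any partner `y` of `x`,
  -- not only the chosen one.
  have hH : ∀ {x y : ℝ → E}, IsSolution t γ (quasiRHS A₀ f) x → IsSolution t γ (linRHS A₀) y →
      (∀ s, ‖x s - y s‖ ≤ B) → ∀ s, H s (x s) = y s := by
    intro x y hx hy hxy s
    have h1 := (hhol (hX s (x s)) hx (hY' s (x s)) hy (hXY' s (x s)) hxy s).1
    rw [hXs, sub_self, norm_zero, Real.zero_rpow hq.ne', mul_zero, zero_sub, norm_neg] at h1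
    exact sub_eq_zero.1 (norm_le_zero_iff.1 h1)
  have hL : ∀ {x y : ℝ → E}, IsSolution t γ (quasiRHS A₀ f) x → IsSolution t γ (linRHS A₀) y →
      (∀ s, ‖x s - y s‖ ≤ B) → ∀ s, L s (y s) = x s := by
    intro x y hx hy hxy s
    have h1 := (hhol (hX' s (y s)) hx (hY s (y s)) hy (hX'Y s (y s)) hxy s).2
    rw [hYs, sub_self, norm_zero, Real.zero_rpow hq.ne', mul_zero, sub_zero] at h1
    exact sub_eq_zero.1 (norm_le_zero_iff.1 h1)
  have hHhol : HolderAll H := holderAll_of_norm_sub_le hC hq hq1 fun s u v => by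
    have := (hhol (hX s u) (hX s v) (hY' s u) (hY' s v) (hXY' s u) (hXY' s v) s).1
    rwa [hXs, hXs] at this
  have hLhol : HolderAll L := holderAll_of_norm_sub_le hC hq hq1 fun s u v => by
    have := (hhol (hX' s u) (hX' s v) (hY s u) (hY s v) (hX'Y s u) (hX'Y s v) s).2
    rwa [hYs, hYs, norm_sub_rev] at this
  have hLH : ∀ s u, L s (H s u) = u := fun s u => by
    rw [hL (hX s u) (hY' s u) (hXY' s u) s, hXs]
  have hHL : ∀ s u, H s (L s u) = u := fun s u => by
    rw [hH (hX' s u) (hY s u) (hX'Y s u) s, hYs]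
  have hHc := hHhol.unifContAll
  have hLc := hLhol.unifContAll
  refine ⟨H, L, ⟨hLH, hHL,
    fun s => (Homeomorph.mk ⟨H s, L s, hLH s, hHL s⟩ (hHc.continuous s)
      (hLc.continuous s)).isHomeomorph,
    fun s => (Homeomorph.mk ⟨L s, H s, hHL s, hLH s⟩ (hLc.continuous s)
      (hHc.continuous s)).isHomeomorph,
    ⟨B, fun s u => ?_⟩, ⟨B, fun s u => ?_⟩, fun x hx => ?_, fun y hy => ?_⟩, ⟨hHc, hLc⟩, hHhol,
    hLhol⟩
  · have := hXY' s u s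
    rwa [hXs, norm_sub_rev] at this
  · have := hX'Y s u s
    rwa [hYs] at this
  · obtain ⟨y, hy, hxy⟩ := S.exists_lin_near hx
    rwa [funext (hH hx hy hxy)]
  · obtain ⟨x, hx, hxy⟩ := S.exists_quasi_near hy
    rwa [funext (hL hx hy hxy)]

end

end DEPCAG

end

theorem corollary3p3 {E : Type*} [NormedAddCommGroup E] [NormedSpace ℝ E]
    [FiniteDimensional ℝ E]
    (t ζ : ℤ → ℝ) (γ : ℝ → ℝ) (θ : ℝ) (hγ : DEPCAG.IsPiecewiseConstArg t ζ γ θ)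
    (A₀ : ℝ → E →L[ℝ] E) (f : ℝ → E → E → E)
    (hA₀c : DEPCAG.PiecewiseContinuous t A₀)
    (hfc : ∀ x y, DEPCAG.PiecewiseContinuous t (fun s => f s x y))
    (M₀ μ ℓ₁ ℓ₂ : ℝ) (hM₀ : 0 < M₀) (hμ : 0 < μ) (hℓ₁ : 0 < ℓ₁) (hℓ₂ : 0 < ℓ₂)
    (hA₀ : ∀ s, ‖A₀ s‖ ≤ M₀)
    (hf : ∀ s x y, ‖f s x y‖ ≤ μ)
    (hfL : ∀ s x x' y y', ‖f s x y - f s x' y'‖ ≤ ℓ₁ * ‖x - x'‖ + ℓ₂ * ‖y - y'‖)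
    (K α : ℝ) (hdich : DEPCAG.HasExpDichotomy A₀ t ζ K α)
    (hα : 2 * (ℓ₁ + ℓ₂) * K * Real.exp (α * θ) < α)
    (v₀ u₀ : ℝ)
    (hv₀ : v₀ = (Real.exp (ℓ₁ * θ) - 1) / (ℓ₁ * θ) * (M₀ + ℓ₂) * θ) (hv₀1 : v₀ < 1)
    (hu₀ : u₀ = (M₀ + ℓ₂) * θ) (hu₀1 : u₀ < 1) :
    DEPCAG.StronglyTopEquiv t γ (DEPCAG.linRHS A₀) (DEPCAG.quasiRHS A₀ f) ∧
    (α < min (ℓ₁ + (M₀ + ℓ₂) / (1 - v₀) * Real.exp (ℓ₁ * θ)) (M₀ / (1 - u₀)) →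
      DEPCAG.HolderStronglyTopEquiv t γ (DEPCAG.linRHS A₀) (DEPCAG.quasiRHS A₀ f)) := by
  have : CompleteSpace E := FiniteDimensional.complete ℝ E
  obtain ⟨hK, hα0, P, hPP, hP⟩ := hdich
  have hθ := hγ.theta_pos
  -- This is `v₀ < 1` in the form consumed by the weighted contraction.
  have hsmall : (M₀ + ℓ₂) / ℓ₁ * (Real.exp (ℓ₁ * θ) - 1) < 1 := by
    have e : (M₀ + ℓ₂) / ℓ₁ * (Real.exp (ℓ₁ * θ) - 1) = v₀ := by
      rw [hv₀]
      field_simp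
    rwa [e]
  have key := DEPCAG.IsSmallPerturbation.holderStronglyTopEquiv (t := t) (ζ := ζ) (γ := γ)
    (μ := μ) (f := f) (P := P)
    ⟨⟨hγ, hA₀c, hA₀, hM₀, by linarith, hℓ₁, hsmall, by rwa [← hu₀]⟩, ⟨hK, hα0, hPP, hP⟩, hℓ₂, hμ.le,
      ⟨hfc, hfL⟩, hf, hα⟩
  exact ⟨key.imp fun _ => Exists.imp fun _ h => ⟨h.1, h.2.1⟩, fun _ => key⟩
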